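/- Let $\mathbb F$ be an algebraically closed field of characteristic zero. All Lie superalgebras $L=L_{\bar 0}\oplus L_{\bar 1}$ are over $\mathbb F$, isomorphisms preserve parity, superdimensions $\mathrm{sdim}\,L=(\dim L_{\bar 0},\dim L_{\bar 1})$ are ordered componentwise, $Z(K)$ is the center of $K$ and $K^2=[K,K]$. A defining pair of a finite-dimensional Lie superalgebra $L$ is a pair $(K,M)$ of a Lie superalgebra $K$ and a graded ideal $M\subseteq Z(K)\cap K^2$ with $K/M\cong L$; it is maximal if $\mathrm{sdim}\,M$ is maximal among all defining pairs of $L$. Write $\mathrm{Ab}(m,n)$ for the abelian Lie superalgebra of superdimension $(m,n)$, and $H(p,q)$ for the Heisenberg Lie superalgebra with even basis $u_1,\dots,u_p,v_1,\dots,v_p,z$ and odd basis $w_1,\dots,w_q$, in which $[u_i,v_i]=-[v_i,u_i]=z$, $[w_k,w_k]=z$ and all other brackets of basis elements vanish. **Theorem.** Let $L$ be a finite-dimensional Lie superalgebra with $\mathrm{sdim}\,L=(s,t)$. Maximal defining pairs $(K,M)$ of $L$ exist, and $\mathrm{sdim}\,M$ is the same for all of them; so, writing $\mathcal M(L)$ for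 such an $M$, $$\mathrm{smr}(L)=\left(\tfrac12 s(s-1)+\tfrac12 t(t+1),\,st\right)-\mathrm{sdim}\,\mathcal M(L)$$ is well defined. Let $\mathrm{mr}(L)=a+b$, where $(a,b)=\mathrm{smr}(L)$. Then $L$ is nilpotent with $\mathrm{mr}(L)\le 2$ if and only if $L$ is abelian or isomorphic to one of $H(1,0)$, $H(1,0)\oplus\mathrm{Ab}(1,0)$, $H(1,0)\oplus\mathrm{Ab}(0,1)$, $H(0,1)$. More precisely: - $\mathrm{smr}(L)=(0,0)$ if and only if $L$ is abelian; - $L$ is nilpotent with $\mathrm{smr}(L)=(1,0)$ if and only if $L\cong H(1,0)$; - $L$ is nilpotent with $\mathrm{smr}(L)=(2,0)$ if and only if $L\cong H(1,0)\oplus\mathrm{Ab}(1,0)$; - $L$ is nilpotent with $\mathrm{smr}(L)=(1,1)$ if and only if $L\cong H(1,0)\oplus\mathrm{Ab}(0,1)$ or $L\cong H(0,1)$. -/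

import Mathlib

universe u v w

/-- A Lie superalgebra structure over the field `F` (of characteristic zero in all uses below) on
the vector space `L`: a decomposition `L = L₀ ⊕ L₁` indexed by `ZMod 2`, and a bilinear bracket
which respects it, is graded skew-symmetric, and satisfies the graded Jacobi identity. -/
class LieSuperalgebra (F : Type u) (L : Type v) [Field F] [AddCommGroup L] [Module F L] where
  /-- The homogeneous component of the given parity. -/
  part : ZMod 2 → Submodule F L
  isCompl_part : IsCompl (part 0) (part 1)
  /-- The bracket `[x, y]`. -/
  br : L →ₗ[F] L →ₗ[F] L
  br_mem : ∀ {i j : ZMod 2} {x y : L}, x ∈ part i → y ∈ part j → br x y ∈ part (i + j)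
  br_skew : ∀ {i j : ZMod 2} {x y : L}, x ∈ part i → y ∈ part j →
    br x y = -((-1 : F) ^ (i.val * j.val) • br y x)
  br_jacobi : ∀ {i j : ZMod 2} {x y : L}, x ∈ part i → y ∈ part j → ∀ z : L,
    br x (br y z) = br (br x y) z + (-1 : F) ^ (i.val * j.val) • br y (br x z)

namespace LieSuperalgebra

section Basic

variable (F : Type u) [Field F]
variable (L : Type v) [AddCommGroup L] [Module F L] [LieSuperalgebra F L]

/-- `L` is abelian: all brackets vanish. -/
def Abelian : Prop := ∀ x y : L, br (F := F) x y = 0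

/-- The center `Z(L) = {x | [x, L] = 0}`. -/
def center : Submodule F L := LinearMap.ker (br (F := F) (L := L))

/-- The derived subalgebra `L² = [L, L]`, the linear span of all brackets. -/
def derived : Submodule F L := Submodule.map₂ (br (F := F) (L := L)) ⊤ ⊤

/-- The lower central series `L, [L, L], [L, [L, L]], …`. -/
def lowerCentral : ℕ → Submodule F L
  | 0 => ⊤
  | n + 1 => Submodule.map₂ (br (F := F) (L := L)) ⊤ (lowerCentral n)

/-- `L` is nilpotent: its lower central series reaches zero. -/
def Nilpotent : Prop := ∃ n : ℕ, lowerCentral F L n = ⊥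

/-- The superdimension of `L`. -/
noncomputable def sdim : ℕ × ℕ :=
  (Module.finrank F (part (F := F) (L := L) 0), Module.finrank F (part (F := F) (L := L) 1))

variable {L} in
/-- The superdimension of a graded subspace `M` of `L`. -/
noncomputable def sdimSub (M : Submodule F L) : ℕ × ℕ :=
  (Module.finrank F (M ⊓ part 0 : Submodule F L), Module.finrank F (M ⊓ part 1 : Submodule F L))

end Basic

section Hom

variable {F : Type u} [Field F]
variable {L : Type v} [AddCommGroup L] [Module F L] [LieSuperalgebra F L]
variable {L' : Type w} [AddCommGroup L'] [Module F L'] [LieSuperalgebra F L']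

/-- A homomorphism of Lie superalgebras: a parity-preserving linear map compatible with the
brackets. -/
def IsHom (f : L →ₗ[F] L') : Prop :=
  (∀ (i : ZMod 2) (x : L), x ∈ part (F := F) i → f x ∈ part (F := F) i) ∧
    ∀ x y : L, f (br (F := F) x y) = br (F := F) (f x) (f y)

variable (F L L') in
/-- `L ≅ L'` as Lie superalgebras. -/
def Iso : Prop := ∃ e : L ≃ₗ[F] L', IsHom (e : L →ₗ[F] L')

end Hom

section Multiplier

variable (F : Type u) [Field F]
variable (L : Type v) [AddCommGroup L] [Module F L] [LieSuperalgebra F L]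

/-- `(K, M)` is a defining pair of `L`: `L ≅ K / M` and `M ⊆ Z(K) ∩ K²`. The isomorphism
`K / M ≅ L` is given as a surjective homomorphism `K → L` with kernel `M`; in particular `M` is a
graded ideal of `K`. -/
def IsDefiningPair (K : Type w) [AddCommGroup K] [Module F K] [LieSuperalgebra F K]
    (M : Submodule F K) : Prop :=
  (∃ f : K →ₗ[F] L, IsHom f ∧ Function.Surjective f ∧ LinearMap.ker f = M) ∧
    M ≤ center F K ⊓ derived F K

/-- Some defining pair `(K, M)` of `L` has `sdim M = d`. (For finite-dimensional `L`, every such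
`K` is finite-dimensional, and up to isomorphism it lives in the universe of `L`.) -/
def IsDefiningSdim (d : ℕ × ℕ) : Prop :=
  ∃ (K : Type v) (_ : AddCommGroup K) (_ : Module F K) (_ : LieSuperalgebra F K)
    (M : Submodule F K), IsDefiningPair F L K M ∧ sdimSub F M = d

/-- `d` is the superdimension of a multiplier of `L`, i.e. of the `M` of a maximal defining pair
`(K, M)`, for the componentwise order on superdimensions. -/
def IsMultiplierSdim (d : ℕ × ℕ) : Prop := Maximal (IsDefiningSdim F L) d

/-- `sdim 𝓜(L)`, the superdimension of the multiplier. -/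
noncomputable def multiplierSdim : ℕ × ℕ := Classical.epsilon (IsMultiplierSdim F L)

/-- The super-multiplier-rank
`smr(L) = (s(s-1)/2 + t(t+1)/2, st) - sdim 𝓜(L)`, where `(s, t) = sdim L`. Both integer divisions
are exact. -/
noncomputable def smr : ℤ × ℤ :=
  let s : ℤ := (sdim F L).1
  let t : ℤ := (sdim F L).2
  (s * (s - 1) / 2 + t * (t + 1) / 2, s * t) -
    (((multiplierSdim F L).1 : ℤ), ((multiplierSdim F L).2 : ℤ))

/-- The multiplier-rank `mr(L) = |smr(L)|`, where `|(a, b)| = a + b`. -/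
noncomputable def mr : ℤ := (smr F L).1 + (smr F L).2

end Multiplier

section Prod

variable {F : Type u} [Field F]
variable {L : Type v} [AddCommGroup L] [Module F L] [LieSuperalgebra F L]
variable {L' : Type w} [AddCommGroup L'] [Module F L'] [LieSuperalgebra F L']

/-- The direct sum `L ⊕ L'`, with componentwise parity and bracket. -/
instance instProd : LieSuperalgebra F (L × L') where
  part i := (part i).prod (part i)
  isCompl_part := by
    have h := isCompl_part (F := F) (L := L)
    have h' := isCompl_part (F := F) (L := L')
    constructor
    · rw [disjoint_iff, Submodule.prod_inf_prod, h.inf_eq_bot, h'.inf_eq_bot, Submodule.prod_bot]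
    · rw [codisjoint_iff, Submodule.prod_sup_prod, h.sup_eq_top, h'.sup_eq_top, Submodule.prod_top]
  br := LinearMap.mk₂ F (fun x y => (br (F := F) x.1 y.1, br (F := F) x.2 y.2))
    (by intros; simp) (by intros; simp) (by intros; simp) (by intros; simp)
  br_mem hx hy := ⟨br_mem hx.1 hy.1, br_mem hx.2 hy.2⟩
  br_skew hx hy := Prod.ext (br_skew hx.1 hy.1) (br_skew hx.2 hy.2)
  br_jacobi hx hy z := Prod.ext (br_jacobi hx.1 hy.1 z.1) (br_jacobi hx.2 hy.2 z.2)

end Prod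

/-- The underlying space of `Ab(m, n)`: even part `Fᵐ`, odd part `Fⁿ`. -/
def Ab (F : Type u) (m n : ℕ) : Type u := (Fin m → F) × (Fin n → F)

/-- The underlying space of `H(p, q)`: an element `((a, b, c), d)` stands for
`∑ aᵢ uᵢ + ∑ bᵢ vᵢ + c z + ∑ dₖ wₖ`, where `uᵢ, vᵢ, z` are even and `wₖ` is odd. -/
def H (F : Type u) (p q : ℕ) : Type u := ((Fin p → F) × (Fin p → F) × F) × (Fin q → F)

section Models

variable (F : Type u) [Field F]

instance (m n : ℕ) : AddCommGroup (Ab F m n) :=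
  inferInstanceAs (AddCommGroup ((Fin m → F) × (Fin n → F)))

instance (m n : ℕ) : Module F (Ab F m n) :=
  inferInstanceAs (Module F ((Fin m → F) × (Fin n → F)))

instance (p q : ℕ) : AddCommGroup (H F p q) :=
  inferInstanceAs (AddCommGroup (((Fin p → F) × (Fin p → F) × F) × (Fin q → F)))

instance (p q : ℕ) : Module F (H F p q) :=
  inferInstanceAs (Module F (((Fin p → F) × (Fin p → F) × F) × (Fin q → F)))

/-- An element of `Ab(m, n)` as the pair of its even and odd part. -/
def Ab.toProd (m n : ℕ) : Ab F m n ≃ₗ[F] (Fin m → F) × (Fin n → F) := LinearEquiv.refl F _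

/-- An element of `H(p, q)` as the tuple of its coordinates. -/
def H.toProd (p q : ℕ) :
    H F p q ≃ₗ[F] ((Fin p → F) × (Fin p → F) × F) × (Fin q → F) := LinearEquiv.refl F _

/-- The grading of a space identified with `E × O`, with even part `E × 0` and odd part `0 × O`. -/
def prodPart {V E O : Type u} [AddCommGroup V] [Module F V] [AddCommGroup E] [Module F E]
    [AddCommGroup O] [Module F O] (e : V ≃ₗ[F] E × O) (i : ZMod 2) : Submodule F V :=
  if i = 0 then LinearMap.ker (LinearMap.snd F E O ∘ₗ e.toLinearMap)
  else LinearMap.ker (LinearMap.fst F E O ∘ₗ e.toLinearMap)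

section ProdPart

variable {F}
variable {V E O : Type u} [AddCommGroup V] [Module F V] [AddCommGroup E] [Module F E]
  [AddCommGroup O] [Module F O] (e : V ≃ₗ[F] E × O)

theorem mem_prodPart_zero {x : V} : x ∈ prodPart F e 0 ↔ (e x).2 = 0 := by
  simp [prodPart]

theorem mem_prodPart_one {x : V} : x ∈ prodPart F e 1 ↔ (e x).1 = 0 := by
  simp [prodPart]

theorem isCompl_prodPart : IsCompl (prodPart F e 0) (prodPart F e 1) := by
  constructor
  · rw [Submodule.disjoint_def]
    intro x h0 h1
    rw [mem_prodPart_zero] at h0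
    rw [mem_prodPart_one] at h1
    exact e.map_eq_zero_iff.1 (Prod.ext h1 h0)
  · rw [codisjoint_iff, eq_top_iff]
    intro x _
    refine Submodule.mem_sup.2 ⟨e.symm ((e x).1, 0), ?_, e.symm (0, (e x).2), ?_, ?_⟩
    · simp [mem_prodPart_zero]
    · simp [mem_prodPart_one]
    · rw [← map_add, LinearEquiv.symm_apply_eq]
      simp

theorem zmod_two_cases (i : ZMod 2) : i = 0 ∨ i = 1 := by
  revert i
  decide

end ProdPart

/-- The abelian Lie superalgebra `Ab(m, n)` of superdimension `(m, n)`. -/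
instance instAb (m n : ℕ) : LieSuperalgebra F (Ab F m n) where
  part := prodPart F (Ab.toProd F m n)
  isCompl_part := isCompl_prodPart _
  br := 0
  br_mem _ _ := by simp
  br_skew _ _ := by simp
  br_jacobi _ _ _ := by simp

section HeisForm

variable {F} {p q : ℕ}

/-- The form `ω` with `[x, y] = ω(x, y) z` in `H(p, q)`; on the basis, `ω(uᵢ, vᵢ) = 1`,
`ω(vᵢ, uᵢ) = -1`, `ω(wₖ, wₖ) = 1`, and all other values vanish. -/
def heisForm (x y : H F p q) : F :=
  (H.toProd F p q x).1.1 ⬝ᵥ (H.toProd F p q y).1.2.1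
    - (H.toProd F p q x).1.2.1 ⬝ᵥ (H.toProd F p q y).1.1
    + (H.toProd F p q x).2 ⬝ᵥ (H.toProd F p q y).2

/-- The element `c z` of `H(p, q)`. -/
def heisZ (c : F) : H F p q := (H.toProd F p q).symm ((0, 0, c), 0)

theorem heisZ_add (c d : F) : (heisZ (c + d) : H F p q) = heisZ c + heisZ d := by
  simp [heisZ, ← map_add]

theorem heisZ_mul (c d : F) : (heisZ (c * d) : H F p q) = c • heisZ d := by
  simp [heisZ, ← map_smul]

theorem heisZ_zero : (heisZ 0 : H F p q) = 0 := by
  simpa using heisZ_mul (p := p) (q := q) (0 : F) 0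

theorem heisForm_heisZ_left (c : F) (y : H F p q) : heisForm (heisZ c) y = 0 := by
  simp [heisForm, heisZ]

theorem heisForm_heisZ_right (c : F) (x : H F p q) : heisForm x (heisZ c) = 0 := by
  simp [heisForm, heisZ]

end HeisForm

/-- The Heisenberg Lie superalgebra `H(p, q)` of even center: `[uᵢ, vᵢ] = -[vᵢ, uᵢ] = z`,
`[wₖ, wₖ] = z`, and the other brackets of basis elements vanish. -/
instance instH (p q : ℕ) : LieSuperalgebra F (H F p q) where
  part := prodPart F (H.toProd F p q)
  isCompl_part := isCompl_prodPart _
  br := LinearMap.mk₂ F (fun x y => heisZ (heisForm x y))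
    (fun x x' y => by rw [← heisZ_add]; congr 1; simp [heisForm, add_dotProduct]; ring)
    (fun c x y => by rw [← heisZ_mul]; congr 1; simp [heisForm, smul_dotProduct]; ring)
    (fun x y y' => by rw [← heisZ_add]; congr 1; simp [heisForm, dotProduct_add]; ring)
    (fun c x y => by rw [← heisZ_mul]; congr 1; simp [heisForm, dotProduct_smul]; ring)
  br_mem {i j x y} hx hy := by
    rw [LinearMap.mk₂_apply]
    rcases zmod_two_cases i with rfl | rfl <;> rcases zmod_two_cases j with rfl | rfl <;>
      simp only [mem_prodPart_zero, mem_prodPart_one] at hx hy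
    · rw [show (0 + 0 : ZMod 2) = 0 from rfl, mem_prodPart_zero]
      simp [heisZ]
    · have : heisForm x y = 0 := by simp [heisForm, hx, hy]
      rw [this, heisZ_zero]
      exact Submodule.zero_mem _
    · have : heisForm x y = 0 := by simp [heisForm, hx, hy]
      rw [this, heisZ_zero]
      exact Submodule.zero_mem _
    · rw [show (1 + 1 : ZMod 2) = 0 from rfl, mem_prodPart_zero]
      simp [heisZ]
  br_skew {i j x y} hx hy := by
    rw [LinearMap.mk₂_apply, LinearMap.mk₂_apply, ← neg_smul, ← heisZ_mul]
    congr 1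
    rcases zmod_two_cases i with rfl | rfl <;> rcases zmod_two_cases j with rfl | rfl <;>
      simp only [mem_prodPart_zero, mem_prodPart_one] at hx hy <;>
      simp [heisForm, hx, hy, dotProduct_comm, ZMod.val_one]
  br_jacobi _ _ _ := by
    simp [LinearMap.mk₂_apply, heisForm_heisZ_left, heisForm_heisZ_right, heisZ_zero]

end Models

end LieSuperalgebra

/-! The multiplier is computed by scalar 2-cocycles: in each parity, `sdim 𝓜(L)` is the dimension of
cocycles modulo coboundaries. For a defining pair `(K, M)` and a graded section `σ` of `K → L`,
composing `[σ x, σ y]` with functionals on a parity component of `M` gives cocycles, independent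
modulo coboundaries because `M ⊆ K²`; this bounds `sdim M`. A basis of cocycles modulo coboundaries
defines a central extension attaining both bounds at once (`isMultiplierSdim_iff`).

The vector subtracted from in `smr` is the superdimension of the space of graded skew forms, and
coboundaries have total dimension `dim L²`. So `mr(L)` is the codimension of the cocycles in the
skew forms plus `dim L²` (`mr_eq`), a sum of two nonnegative terms.

Let `L` be nilpotent and nonabelian with `mr(L) ≤ 2`, and let `c ≠ 0` be homogeneous in `L² ∩ Z(L)`.
Every cocycle vanishes on `L² × Z(L)`. If `dim L² ≥ 2`, all skew forms would be cocycles, which an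
explicit form built from a functional dual to `c` refutes. Hence `L² = F c` and the cocycles have
codimension at most one. Forms `ζ ∧ l`, with `ζ` dual to the generator of `L²`, then show `dim L ≤
4` if two even elements have a nonzero bracket and `dim L ≤ 2` if some odd `w` has `[w, w] ≠ 0`; for
odd `c` there are two independent non-cocycles, a contradiction. An embedded `H(1,0)` or `H(0,1)`
fills `L` up to one homogeneous vector (`Nilpotent.iso_of_mr_le_two`). Computing `smr` for the
models gives the converse and separates the cases. -/

namespace LieSuperalgebra

/-! ### Parity projections. -/

section Proj

variable (F : Type u) [Field F]
variable {L : Type v} [AddCommGroup L] [Module F L] [LieSuperalgebra F L]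

/-- The projection of a Lie superalgebra onto its component of parity `i`. -/
noncomputable def proj (i : ZMod 2) : L →ₗ[F] L :=
  if i = 0 then (part 0).projection (part 1) isCompl_part
  else (part 1).projection (part 0) isCompl_part.symm

theorem proj_mem (i : ZMod 2) (x : L) : proj F i x ∈ part (F := F) i := by
  rcases zmod_two_cases i with rfl | rfl
  · simp [proj]
  · simp [proj]

theorem proj_zero_add_proj_one (x : L) : proj F 0 x + proj F 1 x = x := by
  simpa [proj] using
    Submodule.projection_add_projection_eq_self (isCompl_part (F := F) (L := L)) x

variable {F}

theorem proj_of_mem {i : ZMod 2} {x : L} (hx : x ∈ part (F := F) i) : proj F i x = x := by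
  rcases zmod_two_cases i with rfl | rfl
  · simpa [proj] using hx
  · simpa [proj] using hx

theorem proj_of_mem_of_ne {i j : ZMod 2} {x : L} (hx : x ∈ part (F := F) j) (h : j ≠ i) :
    proj F i x = 0 := by
  rcases zmod_two_cases i with rfl | rfl <;> rcases zmod_two_cases j with rfl | rfl
  · exact absurd rfl h
  · simpa [proj] using hx
  · simpa [proj] using hx
  · exact absurd rfl h

theorem eq_zero_of_mem_part_of_mem_part {i j : ZMod 2} (h : i ≠ j) {x : L}
    (hi : x ∈ part (F := F) i) (hj : x ∈ part (F := F) j) : x = 0 := by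
  rw [← proj_of_mem hi, proj_of_mem_of_ne hj h.symm]

theorem part_induction {p : L → Prop} (hom : ∀ i, ∀ x ∈ part (F := F) i, p x)
    (hadd : ∀ x y, p x → p y → p (x + y)) (x : L) : p x := by
  rw [← proj_zero_add_proj_one F x]
  exact hadd _ _ (hom 0 _ (proj_mem F 0 x)) (hom 1 _ (proj_mem F 1 x))

theorem linearMap_ext_part {V : Type*} [AddCommGroup V] [Module F V] {f g : L →ₗ[F] V}
    (h : ∀ i, ∀ x ∈ part (F := F) i, f x = g x) : f = g := by
  ext x
  refine part_induction (F := F) (fun i x hx => h i x hx) (fun x y hx hy => ?_) x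
  rw [map_add, map_add, hx, hy]

theorem bilin_ext_part {V : Type*} [AddCommGroup V] [Module F V] {f g : L →ₗ[F] L →ₗ[F] V}
    (h : ∀ i j, ∀ x ∈ part (F := F) i, ∀ y ∈ part (F := F) j, f x y = g x y) : f = g :=
  linearMap_ext_part fun i x hx => linearMap_ext_part fun j y hy => h i j x hx y hy

end Proj

/-! ### Linear structure on spaces of bilinear forms. -/

section FormInstances

variable {F : Type u} [Field F] {L : Type v} [AddCommGroup L] [Module F L]

instance formSubmoduleAddCommGroup (S : Submodule F (L →ₗ[F] L →ₗ[F] F)) : AddCommGroup S :=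
  Submodule.addCommGroup (M := L →ₗ[F] L →ₗ[F] F) S

instance formSubmoduleFree (S : Submodule F (L →ₗ[F] L →ₗ[F] F)) : Module.Free F S :=
  Module.Free.of_divisionRing (K := F) (V := S)

end FormInstances

/-! ### Skew forms, cocycles and coboundaries, and their splitting by parity. -/

section Forms

variable (F : Type u) [Field F]
variable (L : Type v) [AddCommGroup L] [Module F L] [LieSuperalgebra F L]

/-- The graded skew-symmetric bilinear forms on `L`. -/
def skewForms : Submodule F (L →ₗ[F] L →ₗ[F] F) where
  carrier := {β | ∀ i j : ZMod 2, ∀ x ∈ part (F := F) i, ∀ y ∈ part (F := F) j,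
    β x y = -((-1 : F) ^ (i.val * j.val) • β y x)}
  zero_mem' := by intro i j x _ y _; simp
  add_mem' := by
    intro β γ hβ hγ i j x hx y hy
    simp only [LinearMap.add_apply, hβ i j x hx y hy, hγ i j x hx y hy, smul_add, neg_add]
  smul_mem' := by
    intro c β hβ i j x hx y hy
    simp only [LinearMap.smul_apply, hβ i j x hx y hy, smul_neg]
    rw [smul_comm]

/-- The scalar 2-cocycles of `L`. -/
def cocycles : Submodule F (L →ₗ[F] L →ₗ[F] F) where
  carrier := {β | β ∈ skewForms F L ∧
    ∀ i j : ZMod 2, ∀ x ∈ part (F := F) i, ∀ y ∈ part (F := F) j, ∀ z : L,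
      β x (br (F := F) y z) =
        β (br (F := F) x y) z + (-1 : F) ^ (i.val * j.val) • β y (br (F := F) x z)}
  zero_mem' := ⟨Submodule.zero_mem _, by intro i j x _ y _ z; simp⟩
  add_mem' := by
    rintro β γ ⟨hβ, hβ'⟩ ⟨hγ, hγ'⟩
    refine ⟨Submodule.add_mem _ hβ hγ, fun i j x hx y hy z => ?_⟩
    simp only [LinearMap.add_apply, hβ' i j x hx y hy, hγ' i j x hx y hy, smul_add]
    abel
  smul_mem' := by
    rintro c β ⟨hβ, hβ'⟩
    refine ⟨Submodule.smul_mem _ c hβ, fun i j x hx y hy z => ?_⟩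
    simp only [LinearMap.smul_apply, hβ' i j x hx y hy, smul_add]
    rw [smul_comm]

/-- The coboundary `λ ∘ [·, ·]` of a linear functional `λ`. -/
def coboundary : Module.Dual F L →ₗ[F] (L →ₗ[F] L →ₗ[F] F) where
  toFun l := (br (F := F) (L := L)).compr₂ l
  map_add' _ _ := rfl
  map_smul' _ _ := rfl

/-- The scalar 2-coboundaries of `L`. -/
def coboundaries : Submodule F (L →ₗ[F] L →ₗ[F] F) := LinearMap.range (coboundary F L)

/-- The bilinear forms of parity `i`. -/
def parityForms (i : ZMod 2) : Submodule F (L →ₗ[F] L →ₗ[F] F) where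
  carrier := {β | ∀ a b : ZMod 2, a + b ≠ i → ∀ x ∈ part (F := F) a, ∀ y ∈ part (F := F) b,
    β x y = 0}
  zero_mem' := by simp
  add_mem' := by
    intro β γ hβ hγ a b h x hx y hy
    simp [hβ a b h x hx y hy, hγ a b h x hx y hy]
  smul_mem' := by
    intro c β hβ a b h x hx y hy
    simp [hβ a b h x hx y hy]

/-- The projection of bilinear forms onto the forms of parity `i`. -/
noncomputable def formProj (i : ZMod 2) : (L →ₗ[F] L →ₗ[F] F) →ₗ[F] (L →ₗ[F] L →ₗ[F] F) where
  toFun β := β.compl₁₂ (proj F 0) (proj F i) + β.compl₁₂ (proj F 1) (proj F (1 + i))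
  map_add' β γ := by ext; simp; abel
  map_smul' c β := by ext; simp

variable {F L}

theorem coboundary_apply (l : Module.Dual F L) (x y : L) :
    coboundary F L l x y = l (br (F := F) x y) := rfl

theorem formProj_apply (i : ZMod 2) (β : L →ₗ[F] L →ₗ[F] F) (x y : L) :
    formProj F L i β x y =
      β (proj F 0 x) (proj F i y) + β (proj F 1 x) (proj F (1 + i) y) := rfl

theorem formProj_apply_of_mem {i a b : ZMod 2} (β : L →ₗ[F] L →ₗ[F] F) {x y : L}
    (hx : x ∈ part (F := F) a) (hy : y ∈ part (F := F) b) :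
    formProj F L i β x y = if a + b = i then β x y else 0 := by
  rw [formProj_apply]
  rcases zmod_two_cases a with rfl | rfl
  · rw [proj_of_mem hx, proj_of_mem_of_ne hx zero_ne_one, map_zero, LinearMap.zero_apply,
      add_zero, zero_add]
    split_ifs with h
    · rw [← h, proj_of_mem hy]
    · rw [proj_of_mem_of_ne hy h, map_zero]
  · rw [proj_of_mem hx, proj_of_mem_of_ne hx one_ne_zero, map_zero, LinearMap.zero_apply,
      zero_add]
    have key : ∀ b i : ZMod 2, 1 + b = i ↔ b = 1 + i := by decide
    split_ifs with h
    · rw [← (key b i).1 h, proj_of_mem hy]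
    · rw [proj_of_mem_of_ne hy (fun h' => h ((key b i).2 h')), map_zero]

theorem formProj_mem (i : ZMod 2) (β : L →ₗ[F] L →ₗ[F] F) :
    formProj F L i β ∈ parityForms F L i := by
  intro a b h x hx y hy
  rw [formProj_apply_of_mem β hx hy, if_neg h]

theorem formProj_zero_add_formProj_one (β : L →ₗ[F] L →ₗ[F] F) :
    formProj F L 0 β + formProj F L 1 β = β := by
  refine bilin_ext_part fun a b x hx y hy => ?_
  rw [LinearMap.add_apply, LinearMap.add_apply, formProj_apply_of_mem β hx hy,
    formProj_apply_of_mem β hx hy]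
  rcases zmod_two_cases (a + b) with h | h <;> simp [h]

theorem formProj_of_mem {i : ZMod 2} {β : L →ₗ[F] L →ₗ[F] F} (hβ : β ∈ parityForms F L i) :
    formProj F L i β = β := by
  refine bilin_ext_part fun a b x hx y hy => ?_
  rw [formProj_apply_of_mem β hx hy]
  split_ifs with h
  · rfl
  · exact (hβ a b h x hx y hy).symm

theorem formProj_of_mem_of_ne {i j : ZMod 2} {β : L →ₗ[F] L →ₗ[F] F}
    (hβ : β ∈ parityForms F L j) (hij : j ≠ i) : formProj F L i β = 0 := by
  refine bilin_ext_part fun a b x hx y hy => ?_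
  rw [formProj_apply_of_mem β hx hy, LinearMap.zero_apply, LinearMap.zero_apply]
  split_ifs with h
  · exact hβ a b (by rw [h]; exact hij.symm) x hx y hy
  · rfl

theorem finrank_eq_add_finrank_inf_parityForms [FiniteDimensional F L]
    (S : Submodule F (L →ₗ[F] L →ₗ[F] F)) (hS : ∀ β ∈ S, ∀ i, formProj F L i β ∈ S) :
    Module.finrank F S = Module.finrank F (S ⊓ parityForms F L 0 : Submodule F _) +
      Module.finrank F (S ⊓ parityForms F L 1 : Submodule F _) := by
  rw [← Submodule.finrank_sup_add_finrank_inf_eq (V := L →ₗ[F] L →ₗ[F] F)]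
  have h1 : (S ⊓ parityForms F L 0) ⊔ (S ⊓ parityForms F L 1) = S := by
    refine le_antisymm (sup_le inf_le_left inf_le_left) fun β hβ => ?_
    exact Submodule.mem_sup.2 ⟨_, ⟨hS β hβ 0, formProj_mem 0 β⟩, _, ⟨hS β hβ 1, formProj_mem 1 β⟩,
      formProj_zero_add_formProj_one β⟩
  have h2 : (S ⊓ parityForms F L 0) ⊓ (S ⊓ parityForms F L 1) = ⊥ := by
    rw [eq_bot_iff]
    rintro β ⟨⟨_, h0⟩, ⟨_, h1⟩⟩
    refine (Submodule.mem_bot F).2 (bilin_ext_part fun a b x hx y hy => ?_)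
    by_cases h : a + b = 0
    · exact h1 a b (by rw [h]; exact zero_ne_one) x hx y hy
    · exact h0 a b h x hx y hy
  rw [h1, h2, finrank_bot, add_zero]

theorem formProj_mem_skewForms {β : L →ₗ[F] L →ₗ[F] F} (hβ : β ∈ skewForms F L) (i : ZMod 2) :
    formProj F L i β ∈ skewForms F L := by
  intro a b x hx y hy
  rw [formProj_apply_of_mem β hx hy, formProj_apply_of_mem β hy hx, add_comm b a]
  split_ifs
  · exact hβ a b x hx y hy
  · simp

theorem mem_cocycles_of_homogeneous {β : L →ₗ[F] L →ₗ[F] F} (hβ : β ∈ skewForms F L)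
    (h : ∀ i j k : ZMod 2, ∀ x ∈ part (F := F) i, ∀ y ∈ part (F := F) j, ∀ z ∈ part (F := F) k,
      β x (br (F := F) y z) =
        β (br (F := F) x y) z + (-1 : F) ^ (i.val * j.val) • β y (br (F := F) x z)) :
    β ∈ cocycles F L := by
  refine ⟨hβ, fun i j x hx y hy z => ?_⟩
  refine part_induction (F := F) (fun k z hz => h i j k x hx y hy z hz) (fun z w hz hw => ?_) z
  simp only [map_add, hz, hw, smul_add]
  abel

theorem formProj_mem_cocycles {β : L →ₗ[F] L →ₗ[F] F} (hβ : β ∈ cocycles F L) (i : ZMod 2) :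
    formProj F L i β ∈ cocycles F L := by
  refine mem_cocycles_of_homogeneous (formProj_mem_skewForms hβ.1 i)
    fun a b c x hx y hy z hz => ?_
  -- All three terms of the identity have total parity `a + b + c`, so the projection keeps or kills
  -- the identity as a whole.
  rw [formProj_apply_of_mem β hx (br_mem hy hz), formProj_apply_of_mem β (br_mem hx hy) hz,
    formProj_apply_of_mem β hy (br_mem hx hz), ← add_assoc, add_left_comm b a c, ← add_assoc]
  split_ifs
  · exact hβ.2 a b x hx y hy z
  · simp

theorem formProj_coboundary (l : Module.Dual F L) (i : ZMod 2) :
    formProj F L i (coboundary F L l) = coboundary F L (l ∘ₗ proj F i) := by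
  refine bilin_ext_part fun a b x hx y hy => ?_
  rw [formProj_apply_of_mem _ hx hy, coboundary_apply, coboundary_apply, LinearMap.comp_apply]
  split_ifs with h
  · rw [← h, proj_of_mem (br_mem hx hy)]
  · rw [proj_of_mem_of_ne (br_mem hx hy) h, map_zero]

theorem formProj_mem_coboundaries {β : L →ₗ[F] L →ₗ[F] F} (hβ : β ∈ coboundaries F L)
    (i : ZMod 2) : formProj F L i β ∈ coboundaries F L := by
  obtain ⟨l, rfl⟩ := hβ
  exact ⟨_, (formProj_coboundary l i).symm⟩

theorem coboundaries_le_cocycles : coboundaries F L ≤ cocycles F L := by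
  rintro _ ⟨l, rfl⟩
  refine ⟨fun i j x hx y hy => ?_, fun i j x hx y hy z => ?_⟩
  · rw [coboundary_apply, coboundary_apply, br_skew hx hy, map_neg, map_smul]
  · rw [coboundary_apply, coboundary_apply, coboundary_apply, br_jacobi hx hy, map_add, map_smul]

theorem cocycles_le_skewForms : cocycles F L ≤ skewForms F L := fun _ h => h.1

-- Rank-nullity: a functional has zero coboundary exactly when it annihilates `L²`.
variable (F L) in
theorem finrank_coboundaries [FiniteDimensional F L] :
    Module.finrank F (coboundaries F L) = Module.finrank F (derived F L) := by
  have hker : LinearMap.ker (coboundary F L) = (derived F L).dualAnnihilator := by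
    ext l
    rw [LinearMap.mem_ker, Submodule.mem_dualAnnihilator]
    constructor
    · intro h w hw
      have : derived F L ≤ LinearMap.ker l := by
        rw [derived, Submodule.map₂_le]
        intro x _ y _
        exact LinearMap.congr_fun₂ h x y
      exact this hw
    · intro h
      ext x y
      exact h _ (Submodule.apply_mem_map₂ _ trivial trivial)
  have h1 := LinearMap.finrank_range_add_finrank_ker (V := Module.Dual F L)
    (V₂ := L →ₗ[F] L →ₗ[F] F) (coboundary F L)
  have h2 := Subspace.finrank_add_finrank_dualAnnihilator_eq (derived F L)
  rw [hker, Subspace.dual_finrank_eq] at h1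
  rw [coboundaries]
  omega

end Forms

/-! ### Dimensions of symmetric and alternating forms. -/

section SymmetricForms

variable (F : Type u) [Field F] (V : Type v) [AddCommGroup V] [Module F V]

/-- The bilinear forms `β` with `β(y, x) = c β(x, y)`. -/
def flipForms (c : F) : Submodule F (V →ₗ[F] V →ₗ[F] F) where
  carrier := {β | ∀ x y, β y x = c * β x y}
  zero_mem' := by simp
  add_mem' := by
    intro β γ hβ hγ x y
    rw [LinearMap.add_apply, LinearMap.add_apply, hβ, hγ, LinearMap.add_apply,
      LinearMap.add_apply, mul_add]
  smul_mem' := by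
    intro a β hβ x y
    rw [LinearMap.smul_apply, LinearMap.smul_apply, hβ, LinearMap.smul_apply,
      LinearMap.smul_apply, smul_eq_mul, smul_eq_mul, mul_left_comm]

variable [FiniteDimensional F V]

/-- A symmetric form is an arbitrary function on unordered pairs of basis indices. -/
theorem finrank_symmetricForms :
    Module.finrank F (flipForms F V 1) = (Module.finrank F V + 1).choose 2 := by
  let b := Module.finBasis F V
  let f : flipForms F V 1 →ₗ[F] (Sym2 (Fin (Module.finrank F V)) → F) :=
    { toFun := fun β => Sym2.lift ⟨fun i j => β.1 (b i) (b j), fun i j => by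
        simpa using (β.2 (b i) (b j)).symm⟩
      map_add' := fun β γ => by
        ext e
        induction e with | _ i j => simp
      map_smul' := fun c β => by
        ext e
        induction e with | _ i j => simp }
  have hf : Function.Bijective f := by
    constructor
    · intro β γ h
      apply Subtype.ext
      refine b.ext fun i => b.ext fun j => ?_
      simpa [f] using congr_fun h s(i, j)
    · intro g
      let β := Matrix.toLinearMap₂ b b (Matrix.of fun i j => g s(i, j))
      have hβ : ∀ i j, β (b i) (b j) = g s(i, j) := fun i j => by
        simp only [β, Matrix.toLinearMap₂_apply_basis, Matrix.of_apply]
      have hflip : β.flip = β := by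
        refine b.ext fun i => b.ext fun j => ?_
        rw [LinearMap.flip_apply, hβ, hβ, Sym2.eq_swap]
      refine ⟨⟨β, fun x y => ?_⟩, ?_⟩
      · rw [one_mul, ← LinearMap.flip_apply, hflip]
      · ext e
        induction e with | _ i j => simp [f, hβ]
  rw [(LinearEquiv.ofBijective f hf).finrank_eq, Module.finrank_fintype_fun_eq_card, Sym2.card,
    Fintype.card_fin]

theorem finrank_symmetricForms_add_finrank_skewSymmetricForms [CharZero F] :
    Module.finrank F (flipForms F V 1) + Module.finrank F (flipForms F V (-1)) =
      Module.finrank F V * Module.finrank F V := by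
  rw [← Submodule.finrank_sup_add_finrank_inf_eq (V := V →ₗ[F] V →ₗ[F] F)]
  have h1 : flipForms F V 1 ⊔ flipForms F V (-1) = ⊤ := by
    rw [eq_top_iff]
    intro β _
    refine Submodule.mem_sup.2 ⟨(2⁻¹ : F) • (β + β.flip), fun x y => ?_,
      (2⁻¹ : F) • (β - β.flip), fun x y => ?_, ?_⟩
    · simp [add_comm]
    · simp; ring
    · ext x y
      simp; ring
  have h2 : flipForms F V 1 ⊓ flipForms F V (-1) = ⊥ := by
    rw [eq_bot_iff]
    rintro β ⟨hs, ha⟩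
    refine (Submodule.mem_bot F).2 ?_
    ext x y
    have := (hs x y).symm.trans (ha x y)
    have h : (2 : F) * β x y = 0 := by linear_combination this
    simpa using h
  rw [h1, h2, finrank_bot, add_zero, finrank_top, Module.finrank_linearMap,
    Module.finrank_linearMap, Module.finrank_self, mul_one]

theorem finrank_skewSymmetricForms [CharZero F] :
    Module.finrank F (flipForms F V (-1)) = (Module.finrank F V).choose 2 := by
  have h1 := finrank_symmetricForms F V
  have h2 := finrank_symmetricForms_add_finrank_skewSymmetricForms F V
  have h3 := Nat.choose_succ_succ' (Module.finrank F V) 1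
  rw [Nat.choose_one_right, one_add_one_eq_two] at h3
  have h5 : 2 * (Module.finrank F V).choose 2 + Module.finrank F V =
      Module.finrank F V * Module.finrank F V := by
    cases h : Module.finrank F V with
    | zero => simp
    | succ n =>
      have := Nat.div_mul_cancel (Nat.even_mul_succ_self n).two_dvd
      rw [Nat.choose_two_right, Nat.add_sub_cancel, mul_comm (n + 1) n, mul_comm 2, this]
      ring
  omega

end SymmetricForms

/-! ### Superdimension of the space of graded skew forms. -/

section SkewForms

variable (F : Type u) [Field F]
variable (L : Type v) [AddCommGroup L] [Module F L] [LieSuperalgebra F L]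

/-- The projection of a Lie superalgebra onto its component of parity `i`, as a map into it. -/
noncomputable def projPart (i : ZMod 2) : L →ₗ[F] part (F := F) (L := L) i :=
  (proj F i).codRestrict _ (proj_mem F i)

variable {F L}

theorem projPart_of_mem {i : ZMod 2} {x : L} (hx : x ∈ part (F := F) i) :
    projPart F L i x = ⟨x, hx⟩ := Subtype.ext (proj_of_mem hx)

theorem projPart_of_mem_of_ne {i j : ZMod 2} {x : L} (hx : x ∈ part (F := F) j) (h : j ≠ i) :
    projPart F L i x = 0 := Subtype.ext (proj_of_mem_of_ne hx h)

variable (F L) [FiniteDimensional F L]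

/-- An odd form lives on `L₀ × L₁` and `L₁ × L₀`, and skewness makes the second block minus the
transpose of the first. -/
theorem finrank_skewForms_one :
    Module.finrank F (skewForms F L ⊓ parityForms F L 1 : Submodule F _) =
      (sdim F L).1 * (sdim F L).2 := by
  let f : (skewForms F L ⊓ parityForms F L 1 : Submodule F _) →ₗ[F]
      (part (F := F) (L := L) 0 →ₗ[F] part (F := F) (L := L) 1 →ₗ[F] F) :=
    { toFun := fun β => β.1.compl₁₂ (part 0).subtype (part 1).subtype
      map_add' := fun _ _ => rfl
      map_smul' := fun _ _ => rfl }
  have hf : Function.Bijective f := by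
    constructor
    · refine (injective_iff_map_eq_zero f).2 ?_
      rintro ⟨β, hs, hp⟩ h
      have h01 : ∀ x ∈ part (F := F) (L := L) 0, ∀ y ∈ part (F := F) (L := L) 1, β x y = 0 :=
        fun x hx y hy => LinearMap.congr_fun₂ h ⟨x, hx⟩ ⟨y, hy⟩
      refine Subtype.ext (bilin_ext_part fun a b x hx y hy => ?_)
      change β x y = 0
      rcases zmod_two_cases a with rfl | rfl <;> rcases zmod_two_cases b with rfl | rfl
      · exact hp 0 0 (by decide) x hx y hy
      · exact h01 x hx y hy
      · rw [hs 1 0 x hx y hy, h01 y hy x hx]; simp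
      · exact hp 1 1 (by decide) x hx y hy
    · intro γ
      let β : L →ₗ[F] L →ₗ[F] F := γ.compl₁₂ (projPart F L 0) (projPart F L 1)
      have hβ : ∀ x y, β x y = γ (projPart F L 0 x) (projPart F L 1 y) := fun _ _ => rfl
      have h10 : ∀ x ∈ part (F := F) (L := L) 1, ∀ y, β x y = 0 := fun x hx y => by
        rw [hβ, projPart_of_mem_of_ne hx one_ne_zero, map_zero, LinearMap.zero_apply]
      have h00 : ∀ y ∈ part (F := F) (L := L) 0, ∀ x, β x y = 0 := fun x hx y => by
        rw [hβ, projPart_of_mem_of_ne hx zero_ne_one, map_zero]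
      refine ⟨⟨β - β.flip, fun a b x hx y hy => ?_, fun a b h x hx y hy => ?_⟩, ?_⟩
      · simp only [LinearMap.sub_apply, LinearMap.flip_apply]
        rcases zmod_two_cases a with rfl | rfl <;> rcases zmod_two_cases b with rfl | rfl
        · simp
        · simp
        · simp
        · rw [h10 x hx, h10 y hy]; simp
      · simp only [LinearMap.sub_apply, LinearMap.flip_apply]
        rcases zmod_two_cases a with rfl | rfl <;> rcases zmod_two_cases b with rfl | rfl
        · rw [h00 x hx, h00 y hy, sub_zero]
        · exact absurd rfl h
        · exact absurd rfl h
        · rw [h10 x hx, h10 y hy, sub_zero]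
      · ext x y
        change β x y - β y x = γ x y
        rw [h10 y y.2, sub_zero, hβ, projPart_of_mem x.2, projPart_of_mem y.2]
  rw [(LinearEquiv.ofBijective f hf).finrank_eq, Module.finrank_linearMap,
    Module.finrank_linearMap, Module.finrank_self, mul_one]
  rfl

/-- An even form is a pair of blocks, alternating on `L₀` and, by the sign rule, symmetric on `L₁`.
-/
theorem finrank_skewForms_zero [CharZero F] :
    Module.finrank F (skewForms F L ⊓ parityForms F L 0 : Submodule F _) =
      (sdim F L).1.choose 2 + ((sdim F L).2 + 1).choose 2 := by
  let f : (skewForms F L ⊓ parityForms F L 0 : Submodule F _) →ₗ[F]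
      (flipForms F (part (F := F) (L := L) 0) (-1) ×
        flipForms F (part (F := F) (L := L) 1) 1) :=
    { toFun := fun β =>
        (⟨β.1.compl₁₂ (part 0).subtype (part 0).subtype, fun x y => by
            simpa using β.2.1 0 0 y y.2 x x.2⟩,
          ⟨β.1.compl₁₂ (part 1).subtype (part 1).subtype, fun x y => by
            simpa [ZMod.val_one] using β.2.1 1 1 y y.2 x x.2⟩)
      map_add' := fun _ _ => rfl
      map_smul' := fun _ _ => rfl }
  have hf : Function.Bijective f := by
    constructor
    · refine (injective_iff_map_eq_zero f).2 ?_
      rintro ⟨β, hs, hp⟩ h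
      refine Subtype.ext (bilin_ext_part fun a b x hx y hy => ?_)
      change β x y = 0
      rcases zmod_two_cases a with rfl | rfl <;> rcases zmod_two_cases b with rfl | rfl
      · exact LinearMap.congr_fun₂ (congrArg Subtype.val (congrArg Prod.fst h)) ⟨x, hx⟩ ⟨y, hy⟩
      · exact hp 0 1 (by decide) x hx y hy
      · exact hp 1 0 (by decide) x hx y hy
      · exact LinearMap.congr_fun₂ (congrArg Subtype.val (congrArg Prod.snd h)) ⟨x, hx⟩ ⟨y, hy⟩
    · rintro ⟨⟨α, hα⟩, ⟨γ, hγ⟩⟩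
      let β : L →ₗ[F] L →ₗ[F] F := α.compl₁₂ (projPart F L 0) (projPart F L 0) +
        γ.compl₁₂ (projPart F L 1) (projPart F L 1)
      have hβ : ∀ x y, β x y = α (projPart F L 0 x) (projPart F L 0 y) +
        γ (projPart F L 1 x) (projPart F L 1 y) := fun _ _ => rfl
      refine ⟨⟨β, fun a b x hx y hy => ?_, fun a b h x hx y hy => ?_⟩, ?_⟩
      · rw [hβ, hβ, hα, hγ]
        rcases zmod_two_cases a with rfl | rfl <;> rcases zmod_two_cases b with rfl | rfl <;>
          simp [projPart_of_mem_of_ne hx, projPart_of_mem_of_ne hy, ZMod.val_one]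
      · rw [hβ]
        rcases zmod_two_cases a with rfl | rfl <;> rcases zmod_two_cases b with rfl | rfl
        · exact absurd rfl h
        · simp [projPart_of_mem_of_ne hx, projPart_of_mem_of_ne hy]
        · simp [projPart_of_mem_of_ne hx, projPart_of_mem_of_ne hy]
        · exact absurd rfl h
      · refine Prod.ext (Subtype.ext ?_) (Subtype.ext ?_)
        · ext x y
          change β x y = α x y
          simp [hβ, projPart_of_mem x.2, projPart_of_mem y.2, projPart_of_mem_of_ne x.2]
        · ext x y
          change β x y = γ x y
          simp [hβ, projPart_of_mem x.2, projPart_of_mem y.2, projPart_of_mem_of_ne x.2]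
  rw [(LinearEquiv.ofBijective f hf).finrank_eq, Module.finrank_prod,
    finrank_skewSymmetricForms, finrank_symmetricForms]
  rfl

end SkewForms

/-! ### Dimension counts modulo a subspace. -/

section LinearAlgebra

variable {F : Type u} [Field F] {V : Type v} [AddCommGroup V] [Module F V]
variable {X : Type w} [AddCommGroup X] [Module F X] [FiniteDimensional F X]

/-- The image of `f` is a copy of `V` inside `B` meeting `A` only in zero. The lower bounds below
for `dim B - dim A` come from this. -/
theorem finrank_add_finrank_le_of_map_mem (f : V →ₗ[F] X) {A B : Submodule F X} (hAB : A ≤ B)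
    (hB : ∀ v, f v ∈ B) (hA : ∀ v, f v ∈ A → v = 0) :
    Module.finrank F V + Module.finrank F A ≤ Module.finrank F B := by
  have hinj : Function.Injective f :=
    (injective_iff_map_eq_zero f).2 fun v hv => hA v (by rw [hv]; exact A.zero_mem)
  have hinf : LinearMap.range f ⊓ A = ⊥ := by
    rw [eq_bot_iff]
    rintro _ ⟨⟨v, rfl⟩, hv⟩
    rw [hA v hv, map_zero]
    exact Submodule.zero_mem _
  have h := Submodule.finrank_sup_add_finrank_inf_eq (LinearMap.range f) A
  rw [hinf, finrank_bot, add_zero, LinearMap.finrank_range_of_inj hinj] at h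
  rw [← h]
  refine Submodule.finrank_mono (sup_le ?_ hAB)
  rintro _ ⟨v, rfl⟩
  exact hB v

/-- For a complement `Q` of `A`, a basis of `Q ∩ B` represents a basis of `B / A`. -/
theorem exists_linearIndependent_mod {A B : Submodule F X} (hAB : A ≤ B) :
    ∃ φ : Fin (Module.finrank F B - Module.finrank F A) → X,
      (∀ k, φ k ∈ B) ∧ ∀ c : Fin (Module.finrank F B - Module.finrank F A) → F,
        ∑ k, c k • φ k ∈ A → c = 0 := by
  obtain ⟨Q, hQ⟩ := exists_isCompl A
  have hdim : Module.finrank F (Q ⊓ B : Submodule F X) =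
      Module.finrank F B - Module.finrank F A := by
    have h := Submodule.finrank_sup_add_finrank_inf_eq A (Q ⊓ B)
    rw [← sup_inf_assoc_of_le Q hAB, hQ.sup_eq_top, top_inf_eq, ← inf_assoc, hQ.inf_eq_bot,
      bot_inf_eq, finrank_bot, add_zero] at h
    omega
  let b := Module.finBasisOfFinrankEq F (Q ⊓ B : Submodule F X) hdim
  refine ⟨fun k => (b k : X), fun k => (b k).2.2, fun c hc => ?_⟩
  have hsum : ∑ k, c k • b k = 0 := by
    apply Subtype.ext
    have hmem : ((∑ k, c k • b k : (Q ⊓ B : Submodule F X)) : X) ∈ A := by simpa using hc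
    have hQ' := (∑ k, c k • b k : (Q ⊓ B : Submodule F X)).2.1
    exact (Submodule.disjoint_def.1 hQ.disjoint) _ hmem hQ'
  funext k
  exact Fintype.linearIndependent_iff.1 b.linearIndependent c hsum k

end LinearAlgebra

/-! ### The center is graded and two-sided. -/

section Center

variable {F : Type u} [Field F]
variable {L : Type v} [AddCommGroup L] [Module F L] [LieSuperalgebra F L]

/-- For homogeneous `y`, the brackets of `y` with the two components of `x` have different parities
and sum to zero, so both vanish. -/
theorem proj_mem_center {x : L} (hx : x ∈ center F L) (i : ZMod 2) :
    proj F i x ∈ center F L := by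
  refine LinearMap.mem_ker.2 (linearMap_ext_part fun j y hy => ?_)
  have h : br (F := F) (proj F 0 x) y + br (F := F) (proj F 1 x) y = 0 := by
    rw [← LinearMap.add_apply, ← map_add, proj_zero_add_proj_one, LinearMap.mem_ker.1 hx,
      LinearMap.zero_apply]
  have h0 := br_mem (proj_mem F 0 x) hy
  have h1 := br_mem (proj_mem F 1 x) hy
  have hne : (0 + j : ZMod 2) ≠ 1 + j := by simp
  have h0' : br (F := F) (proj F 0 x) y = 0 := by
    refine eq_zero_of_mem_part_of_mem_part hne h0 ?_
    rw [eq_neg_of_add_eq_zero_left h]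
    exact Submodule.neg_mem _ h1
  rcases zmod_two_cases i with rfl | rfl
  · exact h0'
  · rwa [h0', zero_add] at h

theorem br_of_mem_center_left {x : L} (hx : x ∈ center F L) (y : L) : br (F := F) x y = 0 :=
  LinearMap.congr_fun (LinearMap.mem_ker.1 hx) y

theorem br_of_mem_center_right {x : L} (hx : x ∈ center F L) (y : L) : br (F := F) y x = 0 := by
  refine part_induction (F := F) (p := fun y => br (F := F) y x = 0) (fun j y hy => ?_) (fun y z hy hz => ?_) y
  · rw [← proj_zero_add_proj_one F x, map_add, br_skew hy (proj_mem F 0 x),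
      br_skew hy (proj_mem F 1 x), br_of_mem_center_left (proj_mem_center hx 0),
      br_of_mem_center_left (proj_mem_center hx 1)]
    simp
  · rw [map_add, LinearMap.add_apply, hy, hz, add_zero]

end Center

/-! ### Upper bound for the kernel of a defining pair. -/

section UpperBound

variable {F : Type u} [Field F]
variable {L : Type v} [AddCommGroup L] [Module F L] [LieSuperalgebra F L]
variable {K : Type w} [AddCommGroup K] [Module F K] [LieSuperalgebra F K]

theorem IsHom.map_proj {f : K →ₗ[F] L} (hf : IsHom f) (i : ZMod 2) (x : K) :
    f (proj F i x) = proj F i (f x) := by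
  refine part_induction (F := F) (p := fun x => f (proj F i x) = proj F i (f x))
    (fun j x hx => ?_) (fun x y hx hy => ?_) x
  · by_cases h : j = i
    · subst h
      rw [proj_of_mem hx, proj_of_mem (hf.1 _ _ hx)]
    · rw [proj_of_mem_of_ne hx h, proj_of_mem_of_ne (hf.1 _ _ hx) h, map_zero]
  · simp only [map_add, hx, hy]

/-- Any linear section `τ` becomes graded when replaced by `p₀ τ p₀ + p₁ τ p₁`, with `p₀`, `p₁` the
parity projections; it stays a section since `f` commutes with these. -/
theorem IsHom.exists_graded_section {f : K →ₗ[F] L} (hf : IsHom f)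
    (hs : Function.Surjective f) :
    ∃ σ : L →ₗ[F] K, (∀ x, f (σ x) = x) ∧
      ∀ (i : ZMod 2) (x : L), x ∈ part (F := F) i → σ x ∈ part (F := F) i := by
  obtain ⟨τ, hτ⟩ := f.exists_rightInverse_of_surjective (LinearMap.range_eq_top.2 hs)
  have hτ' : ∀ x, f (τ x) = x := fun x => LinearMap.congr_fun hτ x
  have hpart : ∀ (i : ZMod 2) (x : L), x ∈ part (F := F) i →
      proj F 0 (τ (proj F 0 x)) + proj F 1 (τ (proj F 1 x)) ∈ part (F := F) i := by
    intro i x hx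
    rcases zmod_two_cases i with rfl | rfl
    · rw [proj_of_mem_of_ne hx zero_ne_one, map_zero, map_zero, add_zero]
      exact proj_mem F 0 _
    · rw [proj_of_mem_of_ne hx one_ne_zero, map_zero, map_zero, zero_add]
      exact proj_mem F 1 _
  refine ⟨proj F 0 ∘ₗ τ ∘ₗ proj F 0 + proj F 1 ∘ₗ τ ∘ₗ proj F 1, fun x => ?_, hpart⟩
  simp only [LinearMap.add_apply, LinearMap.comp_apply, map_add, hf.map_proj, hτ']
  rw [proj_of_mem (proj_mem F 0 x), proj_of_mem (proj_mem F 1 x), proj_zero_add_proj_one]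

theorem IsDefiningPair.finrank_add_finrank_coboundaries_le [FiniteDimensional F L]
    {M : Submodule F K} (h : IsDefiningPair F L K M) (i : ZMod 2) :
    Module.finrank F (M ⊓ part i : Submodule F K) +
      Module.finrank F (coboundaries F L ⊓ parityForms F L i : Submodule F _) ≤
      Module.finrank F (cocycles F L ⊓ parityForms F L i : Submodule F _) := by
  obtain ⟨⟨f, hf, hsurj, rfl⟩, hM⟩ := h
  have hMc : LinearMap.ker f ≤ center F K := hM.trans inf_le_left
  have hMd : LinearMap.ker f ≤ derived F K := hM.trans inf_le_right
  obtain ⟨σ, hσ, hσp⟩ := hf.exists_graded_section hsurj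
  set N : Submodule F K := LinearMap.ker f ⊓ part i with hN
  obtain ⟨r, hr⟩ := N.subtype.exists_leftInverse_of_injective (Submodule.ker_subtype N)
  have hr' : ∀ m : N, r m = m := fun m => LinearMap.congr_fun hr m
  -- Only functionals on `N` enter, so `K` need not be known to be finite-dimensional.
  let Φ : Module.Dual F N →ₗ[F] (L →ₗ[F] L →ₗ[F] F) :=
    { toFun := fun μ => ((br (F := F) (L := K)).compl₁₂ σ σ).compr₂ (μ ∘ₗ r ∘ₗ proj F i)
      map_add' := fun _ _ => rfl
      map_smul' := fun _ _ => rfl }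
  have hΦ : ∀ μ x y, Φ μ x y = μ (r (proj F i (br (F := F) (σ x) (σ y)))) := fun _ _ _ => rfl
  have hσf : ∀ k : K, k - σ (f k) ∈ center F K := fun k =>
    hMc (by rw [LinearMap.mem_ker, map_sub, hσ, sub_self])
  -- Since `k - σ (f k)` is central, every bracket of `K` is already a bracket of section values.
  have hbr : ∀ k k' : K,
      br (F := F) (σ (f k)) (σ (f k')) = br (F := F) k k' := by
    intro k k'
    have h1 := br_of_mem_center_left (hσf k) (σ (f k'))
    have h2 := br_of_mem_center_right (hσf k') k
    rw [map_sub, LinearMap.sub_apply, sub_eq_zero] at h1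
    rw [map_sub, sub_eq_zero] at h2
    rw [← h1, h2]
  have hσbr : ∀ x y z : L, br (F := F) (σ x) (σ (br (F := F) y z)) =
      br (F := F) (σ x) (br (F := F) (σ y) (σ z)) := by
    intro x y z
    rw [← hbr (σ x) (br (F := F) (σ y) (σ z)), hf.2]
    simp only [hσ]
  have hσbr' : ∀ x y z : L, br (F := F) (σ (br (F := F) x y)) (σ z) =
      br (F := F) (br (F := F) (σ x) (σ y)) (σ z) := by
    intro x y z
    rw [← hbr (br (F := F) (σ x) (σ y)) (σ z), hf.2]
    simp only [hσ]
  rw [← Subspace.dual_finrank_eq]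
  refine finrank_add_finrank_le_of_map_mem (X := L →ₗ[F] L →ₗ[F] F) Φ
    (inf_le_inf_right _ coboundaries_le_cocycles) (fun μ => ⟨⟨?_, ?_⟩, ?_⟩) fun μ hμ => ?_
  · intro a b x hx y hy
    rw [hΦ, hΦ, br_skew (hσp a x hx) (hσp b y hy)]
    simp only [map_neg, map_smul]
  · intro a b x hx y hy z
    rw [hΦ, hΦ, hΦ, hσbr, hσbr', hσbr, br_jacobi (hσp a x hx) (hσp b y hy)]
    simp only [map_add, map_smul]
  · intro a b hab x hx y hy
    rw [hΦ, proj_of_mem_of_ne (br_mem (hσp a x hx) (hσp b y hy)) hab, map_zero, map_zero]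
  · obtain ⟨⟨l, hl⟩, _⟩ := hμ
    -- If `Φ μ` is the coboundary of `l`, then `μ ∘ r ∘ proj` and `l ∘ f` agree on `K²`, hence on
    -- `M`, where `l ∘ f` vanishes. This is where `M ⊆ K²` is used.
    have hd : derived F K ≤ LinearMap.ker (μ ∘ₗ r ∘ₗ proj F i - l ∘ₗ f) := by
      rw [derived, Submodule.map₂_le]
      intro k _ k' _
      have := LinearMap.congr_fun₂ hl (f k) (f k')
      rw [coboundary_apply, hΦ, hbr, ← hf.2] at this
      rw [LinearMap.mem_ker, LinearMap.sub_apply, sub_eq_zero]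
      exact this.symm
    ext m
    have hm := hd (hMd m.2.1)
    rw [LinearMap.mem_ker, LinearMap.sub_apply, sub_eq_zero, LinearMap.comp_apply,
      LinearMap.comp_apply, LinearMap.comp_apply, proj_of_mem m.2.2, hr',
      LinearMap.mem_ker.1 m.2.1, map_zero] at hm
    exact hm

end UpperBound

/-! ### Central extensions built from families of cocycles. -/

section Extension

variable {F : Type u} [Field F]
variable {L : Type v} [AddCommGroup L] [Module F L] [LieSuperalgebra F L]

/-- The central extension of `L` by a graded vector space `M` given by an even 2-cocycle `h`. -/
@[reducible]
def centralExtension {M : Type w} [AddCommGroup M] [Module F M] (P : ZMod 2 → Submodule F M)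
    (hP : IsCompl (P 0) (P 1)) (h : L →ₗ[F] L →ₗ[F] M)
    (h_mem : ∀ {i j : ZMod 2} {x y : L}, x ∈ part (F := F) i → y ∈ part (F := F) j →
      h x y ∈ P (i + j))
    (h_skew : ∀ {i j : ZMod 2} {x y : L}, x ∈ part (F := F) i → y ∈ part (F := F) j →
      h x y = -((-1 : F) ^ (i.val * j.val) • h y x))
    (h_jacobi : ∀ {i j : ZMod 2} {x y : L}, x ∈ part (F := F) i → y ∈ part (F := F) j → ∀ z : L,
      h x (br (F := F) y z) =
        h (br (F := F) x y) z + (-1 : F) ^ (i.val * j.val) • h y (br (F := F) x z)) :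
    LieSuperalgebra F (M × L) where
  part i := (P i).prod (part i)
  isCompl_part := by
    have h' := isCompl_part (F := F) (L := L)
    constructor
    · rw [disjoint_iff, Submodule.prod_inf_prod, hP.inf_eq_bot, h'.inf_eq_bot, Submodule.prod_bot]
    · rw [codisjoint_iff, Submodule.prod_sup_prod, hP.sup_eq_top, h'.sup_eq_top,
        Submodule.prod_top]
  br := LinearMap.mk₂ F (fun x y => (h x.2 y.2, br (F := F) x.2 y.2))
    (by intros; simp) (by intros; simp) (by intros; simp) (by intros; simp)
  br_mem hx hy := ⟨h_mem hx.2 hy.2, br_mem hx.2 hy.2⟩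
  br_skew hx hy := Prod.ext (h_skew hx.2 hy.2) (br_skew hx.2 hy.2)
  br_jacobi hx hy z := Prod.ext (h_jacobi hx.2 hy.2 z.2) (br_jacobi hx.2 hy.2 z.2)

/-- The functions on `ι` supported on the indices of parity `i`. -/
def supportedOn {ι : Type*} (p : ι → ZMod 2) (V : Type*) [AddCommGroup V] [Module F V]
    (i : ZMod 2) : Submodule F (ι → V) where
  carrier := {m | ∀ s, p s ≠ i → m s = 0}
  zero_mem' := by simp
  add_mem' := by
    intro a b ha hb s hs
    simp [ha s hs, hb s hs]
  smul_mem' := by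
    intro c a ha s hs
    simp [ha s hs]

theorem isCompl_supportedOn {ι : Type*} (p : ι → ZMod 2) (V : Type*) [AddCommGroup V]
    [Module F V] : IsCompl (supportedOn (F := F) p V 0) (supportedOn (F := F) p V 1) := by
  constructor
  · rw [Submodule.disjoint_def]
    intro m h0 h1
    funext s
    rcases zmod_two_cases (p s) with h | h
    · exact h1 s (by rw [h]; exact zero_ne_one)
    · exact h0 s (by rw [h]; exact one_ne_zero)
  · rw [codisjoint_iff, eq_top_iff]
    intro m _
    refine Submodule.mem_sup.2 ⟨fun s => if p s = 0 then m s else 0, fun s hs => if_neg hs,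
      fun s => if p s = 0 then 0 else m s, fun s hs => ?_, ?_⟩
    · exact if_pos ((zmod_two_cases (p s)).resolve_right hs)
    · funext s
      by_cases h : p s = 0 <;> simp [h]

theorem finrank_supportedOn {ι : Type*} [Fintype ι] (p : ι → ZMod 2) (V : Type*)
    [AddCommGroup V] [Module F V] [Module.Finite F V] (i : ZMod 2) :
    Module.finrank F (supportedOn (F := F) p V i) =
      Fintype.card {s // p s = i} * Module.finrank F V := by
  let f : supportedOn (F := F) p V i →ₗ[F] ({s // p s = i} → V) :=
    { toFun := fun m s => m.1 s
      map_add' := fun _ _ => rfl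
      map_smul' := fun _ _ => rfl }
  have hf : Function.Bijective f := by
    constructor
    · intro m m' h
      apply Subtype.ext
      funext s
      by_cases hs : p s = i
      · exact congr_fun h ⟨s, hs⟩
      · rw [m.2 s hs, m'.2 s hs]
    · intro g
      refine ⟨⟨fun s => if hs : p s = i then g ⟨s, hs⟩ else 0, fun s hs => dif_neg hs⟩, ?_⟩
      funext s
      exact dif_pos s.2
  rw [(LinearEquiv.ofBijective f hf).finrank_eq, Module.finrank_pi_fintype, Finset.sum_const,
    Finset.card_univ, smul_eq_mul]

/-- The family is the coordinate tuple of one even cocycle with values in a graded space having a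
basis vector of parity `p s` for each `s`. Independence modulo coboundaries is what puts the whole
kernel into the derived subalgebra. -/
theorem isDefiningSdim_of_cocycles {ι : Type} [Fintype ι] (p : ι → ZMod 2)
    (φ : ι → (L →ₗ[F] L →ₗ[F] F)) (hφ : ∀ s, φ s ∈ cocycles F L)
    (hp : ∀ s, φ s ∈ parityForms F L (p s))
    (hind : ∀ c : ι → F, ∑ s, c s • φ s ∈ coboundaries F L → c = 0) :
    IsDefiningSdim F L (Fintype.card {s // p s = 0}, Fintype.card {s // p s = 1}) := by
  classical
  -- The coefficient line is `F x₀` inside `L` rather than `F`, which keeps the extension in the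
  -- universe of `L`. If `L = 0` there is no nonzero `x₀`, but then every cocycle is zero and
  -- independence forces `ι` to be empty.
  obtain ⟨x₀, hx₀⟩ : ∃ x₀ : L, Nonempty ι → x₀ ≠ 0 := by
    by_cases hL : ∃ x₀ : L, x₀ ≠ 0
    · exact hL.imp fun x hx _ => hx
    · refine ⟨0, fun ⟨s⟩ => ?_⟩
      push Not at hL
      have h0 : φ s = 0 := by ext x y; rw [hL x]; simp
      have := hind (Pi.single s 1) (by
        rw [Finset.sum_eq_single s (fun t _ ht => by rw [Pi.single_eq_of_ne ht, zero_smul])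
          (fun h => absurd (Finset.mem_univ s) h), h0, smul_zero]
        exact Submodule.zero_mem _)
      simpa using congr_fun this s
  let V : Submodule F L := F ∙ x₀
  let e : V := ⟨x₀, Submodule.mem_span_singleton_self x₀⟩
  let h : L →ₗ[F] L →ₗ[F] (ι → V) := LinearMap.mk₂ F (fun x y s => φ s x y • e)
    (by intros; ext; simp [add_smul]) (by intros; ext; simp [mul_smul])
    (by intros; ext; simp [add_smul]) (by intros; ext; simp [mul_smul])
  have hh : ∀ x y s, h x y s = φ s x y • e := fun _ _ _ => rfl
  let inst : LieSuperalgebra F ((ι → V) × L) :=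
    centralExtension (supportedOn p V) (isCompl_supportedOn p V) h
    (fun {i j x y} hx hy s hs => by rw [hh, hp s i j hs.symm x hx y hy, zero_smul])
    (fun {i j x y} hx hy => by
      funext s
      rw [hh, (hφ s).1 i j x hx y hy, Pi.neg_apply, Pi.smul_apply, hh, neg_smul, smul_assoc])
    (fun {i j x y} hx hy z => by
      funext s
      rw [hh, (hφ s).2 i j x hx y hy, Pi.add_apply, Pi.smul_apply, hh, hh, add_smul, smul_assoc])
  refine ⟨(ι → V) × L, inferInstance, inferInstance, inst,
    LinearMap.ker (LinearMap.snd F (ι → V) L), ⟨⟨LinearMap.snd F (ι → V) L, ⟨?_, ?_⟩,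
      Prod.snd_surjective, rfl⟩, le_inf ?_ ?_⟩, ?_⟩
  · exact fun i x hx => hx.2
  · exact fun x y => rfl
  · intro x hx
    have hx : x.2 = 0 := hx
    refine LinearMap.mem_ker.2 (LinearMap.ext fun y => ?_)
    change ((h x.2 y.2, br (F := F) x.2 y.2) : (ι → V) × L) = 0
    rw [hx, map_zero, map_zero]
    rfl
  · intro x hx
    have hx : x.2 = 0 := hx
    by_contra hxd
    -- A functional `θ` killing the derived subalgebra exhibits `∑ c s • φ s` as the coboundary of
    -- `-θ` restricted to `L`, where `c` is `θ` on the kernel basis. So `c = 0`, and `θ` kills the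
    -- kernel, contrary to its choice.
    obtain ⟨θ, hθx, hθ⟩ := Submodule.exists_le_ker_of_notMem hxd
    have hθ' : ∀ a b : L, θ (h a b, br (F := F) a b) = 0 := fun a b =>
      hθ (Submodule.apply_mem_map₂ (br (F := F) (L := (ι → V) × L))
        (Submodule.mem_top (x := ((0, a) : (ι → V) × L)))
        (Submodule.mem_top (x := ((0, b) : (ι → V) × L))))
    let c : ι → F := fun s => θ (Pi.single s e, 0)
    have hθc : ∀ g : ι → F, θ (fun s => g s • e, 0) = ∑ s, g s * c s := by
      intro g
      have : ((fun s => g s • e, 0) : (ι → V) × L) =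
          ∑ s, g s • ((Pi.single s e, 0) : (ι → V) × L) := by
        refine Prod.ext ?_ ?_
        · rw [Prod.fst_sum]
          funext t
          rw [Finset.sum_apply, Finset.sum_eq_single t]
          · simp
          · intro s _ hs
            simp [Pi.single_eq_of_ne hs.symm]
          · simp
        · rw [Prod.snd_sum]; simp
      rw [this, map_sum]
      exact Finset.sum_congr rfl fun s _ => map_smul θ (g s) _
    have hc : c = 0 := by
      refine hind c ⟨-(θ ∘ₗ LinearMap.inr F (ι → V) L), ?_⟩
      ext a b
      have h1 := hθ' a b
      have h2 : ((h a b, br (F := F) a b) : (ι → V) × L) =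
          (fun s => φ s a b • e, 0) + (0, br (F := F) a b) := by
        refine Prod.ext ?_ ?_
        · simp only [Prod.fst_add, add_zero]; rfl
        · simp
      rw [h2, map_add, hθc] at h1
      rw [coboundary_apply, LinearMap.neg_apply, LinearMap.comp_apply, LinearMap.inr_apply,
        eq_comm, ← sub_eq_zero, sub_neg_eq_add, ← h1]
      congr 1
      simp [LinearMap.sum_apply, mul_comm]
    apply hθx
    have hg : ∀ s, ∃ a : F, a • e = x.1 s := fun s => by
      obtain ⟨a, ha⟩ := Submodule.mem_span_singleton.1 (x.1 s).2
      exact ⟨a, Subtype.ext ha⟩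
    choose g hg using hg
    have hxg : x = (fun s => g s • e, 0) := Prod.ext (funext fun s => (hg s).symm) hx
    rw [hxg, hθc, hc]
    simp
  · have hfin : ∀ i : ZMod 2, Module.finrank F
        (LinearMap.ker (LinearMap.snd F (ι → V) L) ⊓ part i : Submodule F ((ι → V) × L)) =
        Fintype.card {s // p s = i} := by
      intro i
      have hmap : (LinearMap.ker (LinearMap.snd F (ι → V) L) ⊓ part i :
          Submodule F ((ι → V) × L)) =
          (supportedOn (F := F) p V i).map (LinearMap.inl F (ι → V) L) := by
        ext x
        constructor
        · rintro ⟨hx, hx'⟩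
          exact ⟨x.1, hx'.1, Prod.ext rfl (Eq.symm hx)⟩
        · rintro ⟨m, hm, rfl⟩
          exact ⟨rfl, hm, Submodule.zero_mem _⟩
      rw [hmap, ← (Submodule.equivMapOfInjective _ LinearMap.inl_injective _).finrank_eq,
        finrank_supportedOn]
      by_cases hι : Nonempty ι
      · rw [finrank_span_singleton (hx₀ hι), mul_one]
      · rw [not_nonempty_iff] at hι
        simp
    exact Prod.ext (hfin 0) (hfin 1)

end Extension

/-! ### The multiplier and the multiplier-rank in terms of cocycles. -/

section Formula

variable (F : Type u) [Field F]
variable (L : Type v) [AddCommGroup L] [Module F L] [FiniteDimensional F L] [LieSuperalgebra F L]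

theorem card_sumElim_eq_zero (m n : ℕ) : Fintype.card
    {s : Fin m ⊕ Fin n // Sum.elim (fun _ => (0 : ZMod 2)) (fun _ => 1) s = 0} = m := by
  rw [Fintype.card_subtype, Finset.card_filter, Fintype.sum_sum_type]
  simp

theorem card_sumElim_eq_one (m n : ℕ) : Fintype.card
    {s : Fin m ⊕ Fin n // Sum.elim (fun _ => (0 : ZMod 2)) (fun _ => 1) s = 1} = n := by
  rw [Fintype.card_subtype, Finset.card_filter, Fintype.sum_sum_type]
  simp

theorem isDefiningSdim_cocycles_sub_coboundaries :
    IsDefiningSdim F L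
      (Module.finrank F (cocycles F L ⊓ parityForms F L 0 : Submodule F _) -
        Module.finrank F (coboundaries F L ⊓ parityForms F L 0 : Submodule F _),
      Module.finrank F (cocycles F L ⊓ parityForms F L 1 : Submodule F _) -
        Module.finrank F (coboundaries F L ⊓ parityForms F L 1 : Submodule F _)) := by
  have hex := fun i : ZMod 2 => exists_linearIndependent_mod (X := L →ₗ[F] L →ₗ[F] F)
    (inf_le_inf_right (parityForms F L i) (coboundaries_le_cocycles (F := F) (L := L)))
  obtain ⟨φ₀, h₀, hi₀⟩ := hex 0
  obtain ⟨φ₁, h₁, hi₁⟩ := hex 1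
  have key := isDefiningSdim_of_cocycles (F := F) (L := L)
    (Sum.elim (fun _ => (0 : ZMod 2)) fun _ => 1) (Sum.elim φ₀ φ₁)
    (by rintro (s | s); exacts [(h₀ s).1, (h₁ s).1])
    (by rintro (s | s); exacts [(h₀ s).2, (h₁ s).2])
    (fun c hc => by
      rw [Fintype.sum_sum_type] at hc
      simp only [Sum.elim_inl, Sum.elim_inr] at hc
      have m₀ : ∑ s, c (Sum.inl s) • φ₀ s ∈ parityForms F L 0 :=
        Submodule.sum_mem _ fun s _ => Submodule.smul_mem _ _ (h₀ s).2
      have m₁ : ∑ s, c (Sum.inr s) • φ₁ s ∈ parityForms F L 1 :=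
        Submodule.sum_mem _ fun s _ => Submodule.smul_mem _ _ (h₁ s).2
      -- Coboundaries are closed under parity projection, so a relation among all the forms splits
      -- into an even and an odd relation.
      have p₀ := formProj_mem_coboundaries hc 0
      have p₁ := formProj_mem_coboundaries hc 1
      rw [map_add, formProj_of_mem m₀, formProj_of_mem_of_ne m₁ one_ne_zero, add_zero] at p₀
      rw [map_add, formProj_of_mem m₁, formProj_of_mem_of_ne m₀ zero_ne_one, zero_add] at p₁
      funext s
      rcases s with s | s
      · exact congr_fun (hi₀ (fun s => c (Sum.inl s)) ⟨p₀, m₀⟩) s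
      · exact congr_fun (hi₁ (fun s => c (Sum.inr s)) ⟨p₁, m₁⟩) s)
  rwa [card_sumElim_eq_zero, card_sumElim_eq_one] at key

theorem IsDefiningSdim.le_cocycles_sub_coboundaries {d : ℕ × ℕ} (h : IsDefiningSdim F L d) :
    d ≤ (Module.finrank F (cocycles F L ⊓ parityForms F L 0 : Submodule F _) -
        Module.finrank F (coboundaries F L ⊓ parityForms F L 0 : Submodule F _),
      Module.finrank F (cocycles F L ⊓ parityForms F L 1 : Submodule F _) -
        Module.finrank F (coboundaries F L ⊓ parityForms F L 1 : Submodule F _)) := by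
  obtain ⟨K, _, _, _, M, hM, rfl⟩ := h
  exact ⟨Nat.le_sub_of_add_le (hM.finrank_add_finrank_coboundaries_le 0),
    Nat.le_sub_of_add_le (hM.finrank_add_finrank_coboundaries_le 1)⟩

/-- The upper bound is itself attained, so it is a greatest element; for the partial order on pairs
this is what makes the maximal element unique. -/
theorem isMultiplierSdim_iff {d : ℕ × ℕ} : IsMultiplierSdim F L d ↔
    d = (Module.finrank F (cocycles F L ⊓ parityForms F L 0 : Submodule F _) -
        Module.finrank F (coboundaries F L ⊓ parityForms F L 0 : Submodule F _),
      Module.finrank F (cocycles F L ⊓ parityForms F L 1 : Submodule F _) -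
        Module.finrank F (coboundaries F L ⊓ parityForms F L 1 : Submodule F _)) := by
  constructor
  · intro h
    exact h.eq_of_le (isDefiningSdim_cocycles_sub_coboundaries F L)
      (h.prop.le_cocycles_sub_coboundaries F L)
  · rintro rfl
    exact ⟨isDefiningSdim_cocycles_sub_coboundaries F L,
      fun d hd _ => hd.le_cocycles_sub_coboundaries F L⟩

theorem existsUnique_isMultiplierSdim : ∃! d : ℕ × ℕ, IsMultiplierSdim F L d :=
  ⟨_, (isMultiplierSdim_iff F L).2 rfl, fun _ h => (isMultiplierSdim_iff F L).1 h⟩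

theorem multiplierSdim_eq : multiplierSdim F L =
    (Module.finrank F (cocycles F L ⊓ parityForms F L 0 : Submodule F _) -
        Module.finrank F (coboundaries F L ⊓ parityForms F L 0 : Submodule F _),
      Module.finrank F (cocycles F L ⊓ parityForms F L 1 : Submodule F _) -
        Module.finrank F (coboundaries F L ⊓ parityForms F L 1 : Submodule F _)) :=
  (isMultiplierSdim_iff F L).1 (Classical.epsilon_spec (existsUnique_isMultiplierSdim F L).exists)

theorem smr_eq [CharZero F] : smr F L =
    ((Module.finrank F (skewForms F L ⊓ parityForms F L 0 : Submodule F _) : ℤ) -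
        Module.finrank F (cocycles F L ⊓ parityForms F L 0 : Submodule F _) +
        Module.finrank F (coboundaries F L ⊓ parityForms F L 0 : Submodule F _),
      (Module.finrank F (skewForms F L ⊓ parityForms F L 1 : Submodule F _) : ℤ) -
        Module.finrank F (cocycles F L ⊓ parityForms F L 1 : Submodule F _) +
        Module.finrank F (coboundaries F L ⊓ parityForms F L 1 : Submodule F _)) := by
  -- Coboundaries are cocycles, so the natural-number subtractions in `multiplierSdim_eq` do not
  -- truncate.
  have hle := fun i : ZMod 2 => Submodule.finrank_mono (M := L →ₗ[F] L →ₗ[F] F)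
    (inf_le_inf_right (parityForms F L i) (coboundaries_le_cocycles (F := F) (L := L)))
  have hchoose : ∀ n : ℕ, ((n.choose 2 : ℕ) : ℤ) = (n : ℤ) * (n - 1) / 2 := by
    intro n
    cases n with
    | zero => simp
    | succ n => rw [Nat.choose_two_right]; push_cast; simp
  rw [smr, multiplierSdim_eq, finrank_skewForms_zero, finrank_skewForms_one]
  refine Prod.ext ?_ ?_
  · simp only [Prod.fst_sub]
    rw [Nat.cast_sub (hle 0), Nat.cast_add, hchoose, hchoose, Nat.cast_succ, add_sub_cancel_right,
      mul_comm ((_ : ℤ) + 1)]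
    ring
  · simp only [Prod.snd_sub]
    rw [Nat.cast_sub (hle 1), Nat.cast_mul]
    ring

/-- The key formula: codimension of the cocycles among skew forms, plus `dim L²`. Only total
dimensions remain, so parities can be ignored in the bounds that follow. -/
theorem mr_eq [CharZero F] : mr F L = (Module.finrank F (skewForms F L) : ℤ) -
    Module.finrank F (cocycles F L) + Module.finrank F (derived F L) := by
  rw [mr, smr_eq, ← finrank_coboundaries,
    finrank_eq_add_finrank_inf_parityForms (skewForms F L) fun _ h i => formProj_mem_skewForms h i,
    finrank_eq_add_finrank_inf_parityForms (cocycles F L) fun _ h i => formProj_mem_cocycles h i,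
    finrank_eq_add_finrank_inf_parityForms (coboundaries F L)
      fun _ h i => formProj_mem_coboundaries h i]
  push_cast
  ring

end Formula

/-! ### Nilpotency and central elements of the derived subalgebra. -/

section Nilpotent

variable {F : Type u} [Field F]
variable {L : Type v} [AddCommGroup L] [Module F L] [LieSuperalgebra F L]

theorem br_mem_derived (x y : L) : br (F := F) x y ∈ derived F L :=
  Submodule.apply_mem_map₂ _ trivial trivial

theorem abelian_iff_br_eq_zero_of_homogeneous : Abelian F L ↔
    ∀ i j, ∀ x ∈ part (F := F) (L := L) i, ∀ y ∈ part (F := F) (L := L) j,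
      br (F := F) x y = 0 := by
  refine ⟨fun h _ _ x _ y _ => h x y, fun h x y => ?_⟩
  have : br (F := F) (L := L) = 0 := bilin_ext_part fun i j x hx y hy => h i j x hx y hy
  rw [this]
  rfl

theorem abelian_iff_derived_eq_bot : Abelian F L ↔ derived F L = ⊥ := by
  constructor
  · intro h
    rw [derived, eq_bot_iff, Submodule.map₂_le]
    intro x _ y _
    exact h x y
  · intro h x y
    have := br_mem_derived (F := F) x y
    rwa [h, Submodule.mem_bot] at this

theorem Abelian.nilpotent (h : Abelian F L) : Nilpotent F L :=
  ⟨1, abelian_iff_derived_eq_bot.1 h⟩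

theorem nilpotent_of_br_br_eq_zero
    (h : ∀ x y z : L, br (F := F) x (br (F := F) y z) = 0) : Nilpotent F L := by
  refine ⟨2, ?_⟩
  rw [lowerCentral, eq_bot_iff, Submodule.map₂_le]
  intro x _ y hy
  have hle : lowerCentral F L 1 ≤ LinearMap.ker (br (F := F) x) := by
    rw [lowerCentral, Submodule.map₂_le]
    intro a _ b _
    exact h x a b
  exact hle hy

theorem proj_br (i : ZMod 2) (x y : L) : proj F i (br (F := F) x y) =
    br (F := F) (proj F 0 x) (proj F i y) + br (F := F) (proj F 1 x) (proj F (1 + i) y) := by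
  have h : (br (F := F) (L := L)).compr₂ (proj F i) =
      (br (F := F) (L := L)).compl₁₂ (proj F 0) (proj F i) +
        (br (F := F) (L := L)).compl₁₂ (proj F 1) (proj F (1 + i)) := by
    refine bilin_ext_part fun a b x hx y hy => ?_
    simp only [LinearMap.compr₂_apply, LinearMap.add_apply, LinearMap.compl₁₂_apply]
    have key : ∀ b i : ZMod 2, 1 + b = i ↔ b = 1 + i := by decide
    have hxy := br_mem hx hy
    rcases zmod_two_cases a with rfl | rfl
    · rw [proj_of_mem hx, proj_of_mem_of_ne hx zero_ne_one, map_zero, LinearMap.zero_apply,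
        add_zero]
      rw [zero_add] at hxy
      by_cases h : b = i
      · subst h; rw [proj_of_mem hy, proj_of_mem hxy]
      · rw [proj_of_mem_of_ne hy h, proj_of_mem_of_ne hxy h, map_zero]
    · rw [proj_of_mem hx, proj_of_mem_of_ne hx one_ne_zero, map_zero, LinearMap.zero_apply,
        zero_add]
      by_cases h : 1 + b = i
      · rw [← (key b i).1 h, proj_of_mem hy, ← h, proj_of_mem hxy]
      · rw [proj_of_mem_of_ne hy (fun h' => h ((key b i).2 h')), proj_of_mem_of_ne hxy h, map_zero]
  exact LinearMap.congr_fun₂ h x y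

theorem proj_mem_derived {x : L} (hx : x ∈ derived F L) (i : ZMod 2) :
    proj F i x ∈ derived F L := by
  have hle : derived F L ≤ (derived F L).comap (proj F i) := by
    conv_lhs => rw [derived]
    rw [Submodule.map₂_le]
    intro x _ y _
    rw [Submodule.mem_comap, proj_br]
    exact Submodule.add_mem _ (br_mem_derived _ _) (br_mem_derived _ _)
  exact hle hx

/-- The center is defined by brackets with `x` on the left, while the lower central series yields
them with `x` on the right; graded skew-symmetry converts one into the other only on homogeneous
components. -/
theorem mem_center_of_br_right_eq_zero {x : L} (hx : ∀ y : L, br (F := F) y x = 0) :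
    x ∈ center F L := by
  have hproj : ∀ i j, ∀ y ∈ part (F := F) (L := L) j, br (F := F) y (proj F i x) = 0 := by
    intro i j y hy
    have h := congrArg (proj F (j + i)) (hx y)
    rw [proj_br, map_zero] at h
    rcases zmod_two_cases j with rfl | rfl
    · rwa [proj_of_mem hy, proj_of_mem_of_ne hy zero_ne_one, map_zero, LinearMap.zero_apply,
        add_zero, zero_add] at h
    · rw [proj_of_mem hy, proj_of_mem_of_ne hy one_ne_zero, map_zero, LinearMap.zero_apply,
        zero_add, ← add_assoc] at h
      rwa [show (1 + 1 : ZMod 2) = 0 from rfl, zero_add] at h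
  refine LinearMap.mem_ker.2 (linearMap_ext_part fun j y hy => ?_)
  rw [← proj_zero_add_proj_one F x, map_add, LinearMap.add_apply, br_skew (proj_mem F 0 x) hy,
    br_skew (proj_mem F 1 x) hy, hproj 0 j y hy, hproj 1 j y hy]
  simp

theorem Nilpotent.exists_homogeneous_mem_center (hn : Nilpotent F L) (hna : ¬Abelian F L) :
    ∃ (i : ZMod 2) (c : L), c ∈ part (F := F) i ∧ c ≠ 0 ∧ c ∈ derived F L ∧ c ∈ center F L := by
  classical
  have hle : ∀ n, lowerCentral F L (n + 1) ≤ derived F L := fun n =>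
    Submodule.map₂_le_map₂_right le_top
  obtain ⟨n, hn0, hn1⟩ : ∃ n, lowerCentral F L (n + 1) ≠ ⊥ ∧ lowerCentral F L (n + 2) = ⊥ := by
    -- If no last nonzero term existed after the zeroth, induction from `L² ≠ 0` would make all of
    -- them nonzero. Starting at index `n + 1` ensures that the term found lies in `L²`.
    by_contra! hcon
    have h1 : ∀ n, lowerCentral F L (n + 1) ≠ ⊥ := by
      intro n
      induction n with
      | zero => exact fun h => hna (abelian_iff_derived_eq_bot.2 h)
      | succ n ih => exact hcon n ih
    obtain ⟨n, hn⟩ := hn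
    refine h1 n ?_
    rw [lowerCentral, hn, Submodule.map₂_bot_right]
  obtain ⟨x, hx, hx0⟩ := Submodule.exists_mem_ne_zero_of_ne_bot hn0
  have hxc : x ∈ center F L := mem_center_of_br_right_eq_zero fun y => by
    have : br (F := F) y x ∈ lowerCentral F L (n + 2) :=
      Submodule.apply_mem_map₂ _ trivial hx
    rwa [hn1, Submodule.mem_bot] at this
  have hxd := hle n hx
  by_cases h0 : proj F 0 x = 0
  · refine ⟨1, proj F 1 x, proj_mem F 1 x, fun h1 => hx0 ?_, proj_mem_derived hxd 1,
      proj_mem_center hxc 1⟩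
    rw [← proj_zero_add_proj_one F x, h0, h1, add_zero]
  · exact ⟨0, proj F 0 x, proj_mem F 0 x, h0, proj_mem_derived hxd 0, proj_mem_center hxc 0⟩

end Nilpotent

/-! ### Test forms, and the vanishing of cocycles on derived times central elements. -/

section SpecialForms

variable {F : Type u} [Field F]
variable {L : Type v} [AddCommGroup L] [Module F L]

/-- The form `ζ(x) λ(y) + c λ(x) ζ(y)`, linear in `λ`. -/
def twoForm (c : F) (ζ : Module.Dual F L) : Module.Dual F L →ₗ[F] (L →ₗ[F] L →ₗ[F] F) where
  toFun l := LinearMap.mk₂ F (fun x y => ζ x * l y + c * (l x * ζ y))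
    (by intros; simp only [map_add]; ring) (by intros; simp only [map_smul, smul_eq_mul]; ring)
    (by intros; simp only [map_add]; ring) (by intros; simp only [map_smul, smul_eq_mul]; ring)
  map_add' l l' := by ext x y; simp; ring
  map_smul' a l := by ext x y; simp; ring

theorem twoForm_apply (c : F) (ζ l : Module.Dual F L) (x y : L) :
    twoForm c ζ l x y = ζ x * l y + c * (l x * ζ y) := rfl

variable [LieSuperalgebra F L]

theorem twoForm_mem_skewForms_of_even {ζ : Module.Dual F L}
    (hζ : ∀ x ∈ part (F := F) (L := L) 1, ζ x = 0) (l : Module.Dual F L) :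
    twoForm (-1) ζ l ∈ skewForms F L := by
  intro i j x hx y hy
  rw [twoForm_apply, twoForm_apply]
  rcases zmod_two_cases i with rfl | rfl <;> rcases zmod_two_cases j with rfl | rfl
  · simp; ring
  · simp; ring
  · simp; ring
  · rw [hζ x hx, hζ y hy]; simp

theorem twoForm_mem_skewForms_of_odd {ζ l : Module.Dual F L}
    (hζ : ∀ x ∈ part (F := F) (L := L) 0, ζ x = 0)
    (hl : ∀ x ∈ part (F := F) (L := L) 0, l x = 0) :
    twoForm 1 ζ l ∈ skewForms F L := by
  intro i j x hx y hy
  rw [twoForm_apply, twoForm_apply]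
  rcases zmod_two_cases i with rfl | rfl <;> rcases zmod_two_cases j with rfl | rfl
  · rw [hζ x hx, hl x hx, hζ y hy]; simp
  · rw [hζ x hx, hl x hx]; simp
  · rw [hζ y hy, hl y hy]; simp
  · simp [ZMod.val_one]; ring

theorem exists_homogeneous_dual {i : ZMod 2} {c : L} (hc : c ∈ part (F := F) i)
    {S : Submodule F L} (hS : ∀ x ∈ S, proj F i x ∈ S) (hcS : c ∉ S) :
    ∃ ζ : Module.Dual F L, ζ c = 1 ∧ (∀ x ∈ S, ζ x = 0) ∧
      ∀ j ≠ i, ∀ x ∈ part (F := F) (L := L) j, ζ x = 0 := by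
  obtain ⟨θ, hθc, hθ⟩ := Submodule.exists_le_ker_of_notMem hcS
  refine ⟨(θ c)⁻¹ • (θ ∘ₗ proj F i), ?_, fun x hx => ?_, fun j hj x hx => ?_⟩
  · simp [proj_of_mem hc, hθc]
  · have : θ (proj F i x) = 0 := hθ (hS x hx)
    simp [this]
  · simp [proj_of_mem_of_ne hx hj]

theorem exists_homogeneous_dual_of_ne_zero {i : ZMod 2} {c : L} (hc : c ∈ part (F := F) i)
    (hc0 : c ≠ 0) : ∃ ζ : Module.Dual F L, ζ c = 1 ∧
      ∀ j ≠ i, ∀ x ∈ part (F := F) (L := L) j, ζ x = 0 := by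
  obtain ⟨ζ, h1, _, h2⟩ := exists_homogeneous_dual (S := ⊥) hc
    (fun x hx => by rw [(Submodule.mem_bot F).1 hx, map_zero]; exact Submodule.zero_mem _)
    (by simpa using hc0)
  exact ⟨ζ, h1, h2⟩

/-- In the cocycle identity for `(x, y, c)` with `c` central, only `β([x, y], c)` survives. -/
theorem cocycle_apply_eq_zero {β : L →ₗ[F] L →ₗ[F] F} (hβ : β ∈ cocycles F L) {c d : L}
    (hc : c ∈ center F L) (hd : d ∈ derived F L) : β d c = 0 := by
  have h : (br (F := F) (L := L)).compr₂ (β.flip c) = 0 := by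
    refine bilin_ext_part fun i j x hx y hy => ?_
    have := hβ.2 i j x hx y hy c
    rw [br_of_mem_center_right hc, br_of_mem_center_right hc, map_zero, map_zero, smul_zero,
      add_zero] at this
    exact this.symm
  have hle : derived F L ≤ LinearMap.ker (β.flip c) := by
    rw [derived, Submodule.map₂_le]
    intro x _ y _
    exact LinearMap.congr_fun₂ h x y
  exact hle hd

end SpecialForms

/-! ### Dimension bounds when the cocycles have small codimension. -/

section Bounds

variable {F : Type u} [Field F]
variable {L : Type v} [AddCommGroup L] [Module F L] [FiniteDimensional F L] [LieSuperalgebra F L]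

/-- Take `ζ ∧ l` with `l` vanishing on `u`, `v`, `z`. The cocycle identity at `(u, v, y)` loses its
terms in `[v, y]` and `[u, y]`, which are multiples of `z`, and reads `l y = 0`. So these forms are
independent modulo cocycles, and the annihilator of the span of `u`, `v`, `z` has dimension at most
one. -/
theorem finrank_le_four_of_even_bracket
    (hcod : Module.finrank F (skewForms F L) ≤ Module.finrank F (cocycles F L) + 1)
    {u v z : L} (hu : u ∈ part (F := F) 0) (hv : v ∈ part (F := F) 0)
    (huv : br (F := F) u v = z) (hz : z ≠ 0) (hd : derived F L = F ∙ z) :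
    Module.finrank F L ≤ 4 := by
  have hz0 : z ∈ part (F := F) 0 := huv ▸ br_mem hu hv
  obtain ⟨ζ, hζz, hζ⟩ := exists_homogeneous_dual_of_ne_zero hz0 hz
  let S : Submodule F L := Submodule.span F (Set.range ![u, v, z])
  have hS : Module.finrank F S ≤ 3 := (finrank_range_le_card (R := F) ![u, v, z]).trans (by simp)
  have hdim := Subspace.finrank_add_finrank_dualAnnihilator_eq S
  have h := finrank_add_finrank_le_of_map_mem (X := L →ₗ[F] L →ₗ[F] F)
    (V := S.dualAnnihilator) (twoForm (-1) ζ ∘ₗ S.dualAnnihilator.subtype) cocycles_le_skewForms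
    (fun l => twoForm_mem_skewForms_of_even (hζ 1 one_ne_zero) l.1) (fun l hl => ?_)
  · omega
  · have hmem : ∀ i, l.1 (![u, v, z] i) = 0 := fun i =>
      (Submodule.mem_dualAnnihilator _).1 l.2 _ (Submodule.subset_span ⟨i, rfl⟩)
    have hlu : l.1 u = 0 := hmem 0
    have hlv : l.1 v = 0 := hmem 1
    have hlz : l.1 z = 0 := hmem 2
    have hcob : ∀ a x y, l.1 a = 0 → twoForm (-1) ζ l.1 a (br (F := F) x y) = 0 := by
      intro a x y ha
      have hxy := br_mem_derived (F := F) x y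
      rw [hd] at hxy
      obtain ⟨k, hk⟩ := Submodule.mem_span_singleton.1 hxy
      rw [← hk, twoForm_apply, ha, map_smul, hlz]
      simp
    apply Subtype.ext
    ext y
    have := hl.2 0 0 u hu v hv y
    simp only [LinearMap.comp_apply, Submodule.subtype_apply] at this
    rw [hcob u v y hlu, hcob v u y hlv, huv, twoForm_apply, hζz, hlz] at this
    simpa using this.symm

variable [CharZero F]

theorem derived_eq_span_of_mr_le_two (hmr : mr F L ≤ 2) {i : ZMod 2} {c : L}
    (hc : c ∈ part (F := F) i) (hc0 : c ≠ 0) (hcd : c ∈ derived F L) (hcc : c ∈ center F L) :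
    derived F L = F ∙ c := by
  have hle : (F ∙ c) ≤ derived F L := (Submodule.span_singleton_le_iff_mem _ _).2 hcd
  by_contra hne
  have hlt := Submodule.finrank_lt_finrank_of_lt (lt_of_le_of_ne hle (Ne.symm hne))
  rw [finrank_span_singleton hc0] at hlt
  obtain ⟨d, hd, hdc⟩ := SetLike.exists_of_lt (lt_of_le_of_ne hle (Ne.symm hne))
  rw [mr_eq] at hmr
  -- Here `dim L² ≥ 2` already exhausts `mr ≤ 2`, leaving codimension zero.
  have hZ : cocycles F L = skewForms F L :=
    Submodule.eq_of_le_of_finrank_le (V := L →ₗ[F] L →ₗ[F] F) cocycles_le_skewForms (by omega)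
  obtain ⟨ζ, hζc, hζ⟩ := exists_homogeneous_dual_of_ne_zero hc hc0
  -- For even `c` the form `ζ ∧ l`, with `l c = 0` and `l d ≠ 0`, has value `-l d` at `(d, c)`. For
  -- odd `c` the symmetric form built from `ζ` alone has value `2` at `(c, c)`.
  rcases zmod_two_cases i with rfl | rfl
  · obtain ⟨l, hld, hl⟩ := Submodule.exists_le_ker_of_notMem hdc
    have hlc : l c = 0 := hl (Submodule.mem_span_singleton_self c)
    have hβ : twoForm (-1) ζ l ∈ cocycles F L := by
      rw [hZ]
      exact twoForm_mem_skewForms_of_even (hζ 1 one_ne_zero) l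
    have := cocycle_apply_eq_zero hβ hcc hd
    rw [twoForm_apply, hlc, hζc] at this
    exact hld (by simpa using this)
  · have hβ : twoForm 1 ζ ζ ∈ cocycles F L := by
      rw [hZ]
      exact twoForm_mem_skewForms_of_odd (hζ 0 zero_ne_one) (hζ 0 zero_ne_one)
    have := cocycle_apply_eq_zero hβ hcc hcd
    rw [twoForm_apply, hζc] at this
    norm_num at this

theorem finrank_skewForms_le_of_mr_le_two (hmr : mr F L ≤ 2) (hna : ¬Abelian F L) :
    Module.finrank F (skewForms F L) ≤ Module.finrank F (cocycles F L) + 1 := by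
  have h : 0 < Module.finrank F (derived F L) :=
    Module.finrank_pos_iff.2 ((Submodule.nontrivial_iff_ne_bot).2
      fun h => hna (abelian_iff_derived_eq_bot.2 h))
  rw [mr_eq] at hmr
  omega

/-- For `ζ ∧ l` with `l z = 0`, the cocycle identity at `(w, w, y)` with `[w, y] = k z` gives `l y =
-2 k l(w)`. At `y = w`, where `k = 1`, this is `3 l(w) = 0`; hence `l = 0`. So the annihilator of
`z` has dimension at most one. -/
theorem finrank_le_two_of_odd_bracket
    (hcod : Module.finrank F (skewForms F L) ≤ Module.finrank F (cocycles F L) + 1)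
    {w z : L} (hw : w ∈ part (F := F) 1)
    (hww : br (F := F) w w = z) (hz : z ≠ 0) (hd : derived F L = F ∙ z) :
    Module.finrank F L ≤ 2 := by
  have hz0 : z ∈ part (F := F) 0 := hww ▸ br_mem hw hw
  obtain ⟨ζ, hζz, hζ⟩ := exists_homogeneous_dual_of_ne_zero hz0 hz
  have hζw : ζ w = 0 := hζ 1 one_ne_zero w hw
  have hdim := Subspace.finrank_add_finrank_dualAnnihilator_eq (F ∙ z)
  rw [finrank_span_singleton hz] at hdim
  have h := finrank_add_finrank_le_of_map_mem (X := L →ₗ[F] L →ₗ[F] F)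
    (V := Submodule.dualAnnihilator (F ∙ z))
    (twoForm (-1) ζ ∘ₗ (Submodule.dualAnnihilator (F ∙ z)).subtype) cocycles_le_skewForms
    (fun l => twoForm_mem_skewForms_of_even (hζ 1 one_ne_zero) l.1) (fun l hl => ?_)
  · omega
  · have hlz : l.1 z = 0 :=
      (Submodule.mem_dualAnnihilator _).1 l.2 _ (Submodule.mem_span_singleton_self z)
    have hco : ∀ y, ∃ k : F, br (F := F) w y = k • z ∧ l.1 y = -(2 * k * l.1 w) := by
      intro y
      have hy := br_mem_derived (F := F) w y
      rw [hd] at hy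
      obtain ⟨k, hk⟩ := Submodule.mem_span_singleton.1 hy
      refine ⟨k, hk.symm, ?_⟩
      have := hl.2 1 1 w hw w hw y
      simp only [LinearMap.comp_apply, Submodule.subtype_apply] at this
      rw [hww, ← hk, twoForm_apply, twoForm_apply, map_smul, map_smul, hζz, hlz, hζw] at this
      simp [ZMod.val_one] at this
      linear_combination -this
    have hlw : l.1 w = 0 := by
      obtain ⟨k, hk, hk'⟩ := hco w
      have : k = 1 := by
        have h1 : (k - 1) • z = 0 := by rw [sub_smul, one_smul, ← hk, hww, sub_self]
        exact sub_eq_zero.1 ((smul_eq_zero.1 h1).resolve_right hz)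
      rw [this] at hk'
      have h3 : (3 : F) * l.1 w = 0 := by linear_combination hk'
      simpa using h3
    apply Subtype.ext
    ext y
    obtain ⟨k, _, hk⟩ := hco y
    rw [hk, hlw]
    simp

/-- With `ζ`, `η` odd functionals dual to `z` and `w`, the symmetric products of `ζ` with `ζ` and
with `η` are independent modulo cocycles: evaluation at `(z, z)` removes the first, the cocycle
identity at `(u, w, w)` the second. -/
theorem finrank_cocycles_add_two_le_of_odd_derived {u w z : L} (hu : u ∈ part (F := F) 0)
    (hw : w ∈ part (F := F) 1) (huw : br (F := F) u w = z) (hz : z ≠ 0)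
    (hzc : z ∈ center F L) (hd : derived F L = F ∙ z) :
    2 + Module.finrank F (cocycles F L) ≤ Module.finrank F (skewForms F L) := by
  have hz1 : z ∈ part (F := F) 1 := by
    have := br_mem hu hw
    rwa [huw, zero_add] at this
  have hww : br (F := F) w w = 0 := by
    have h1 := br_mem_derived (F := F) w w
    rw [hd] at h1
    have h2 : br (F := F) w w ∈ part (F := F) 1 :=
      (Submodule.span_singleton_le_iff_mem _ _).2 hz1 h1
    exact eq_zero_of_mem_part_of_mem_part (by decide) (br_mem hw hw) h2
  obtain ⟨ζ, hζz, hζ⟩ := exists_homogeneous_dual_of_ne_zero hz1 hz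
  have hwz : w ∉ F ∙ z := by
    intro hmem
    obtain ⟨a, ha⟩ := Submodule.mem_span_singleton.1 hmem
    rw [← ha, map_smul, br_of_mem_center_right hzc, smul_zero] at huw
    exact hz huw.symm
  obtain ⟨η, hηw, hηz, hη⟩ := exists_homogeneous_dual hw (S := F ∙ z) (fun x hx => by
    rwa [proj_of_mem ((Submodule.span_singleton_le_iff_mem _ _).2 hz1 hx)]) hwz
  have hηz : η z = 0 := hηz z (Submodule.mem_span_singleton_self z)
  let f : F × F →ₗ[F] Module.Dual F L :=
    (LinearMap.toSpanSingleton F _ ζ).coprod (LinearMap.toSpanSingleton F _ η)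
  have hf : ∀ a x, f a x = a.1 * ζ x + a.2 * η x := fun a x => by simp [f]
  have hfin : Module.finrank F (F × F) = 2 := by simp
  rw [← hfin]
  refine finrank_add_finrank_le_of_map_mem (X := L →ₗ[F] L →ₗ[F] F)
    (twoForm 1 ζ ∘ₗ f) cocycles_le_skewForms (fun a => ?_) fun a ha => ?_
  · refine twoForm_mem_skewForms_of_odd (hζ 0 zero_ne_one) fun x hx => ?_
    rw [hf, hζ 0 zero_ne_one x hx, hη 0 zero_ne_one x hx]
    simp
  · have hzz := cocycle_apply_eq_zero ha hzc (d := z) (huw ▸ br_mem_derived u w)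
    rw [LinearMap.comp_apply, twoForm_apply, hf, hζz, hηz] at hzz
    have ha1 : a.1 = 0 := by
      have : (2 : F) * a.1 = 0 := by linear_combination hzz
      simpa using this
    have hw2 := ha.2 0 1 u hu w hw w
    rw [hww, map_zero, huw, LinearMap.comp_apply, twoForm_apply, twoForm_apply, hf, hf, hζz, hηz,
      hηw, ha1] at hw2
    have ha2 : a.2 = 0 := by
      have : (2 : F) * a.2 = 0 := by simp at hw2; linear_combination -hw2
      simpa using this
    exact Prod.ext ha1 ha2

end Bounds

/-! ### Isomorphisms from injective homomorphisms. -/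

section Iso

variable {F : Type u} [Field F]
variable {L : Type v} [AddCommGroup L] [Module F L] [LieSuperalgebra F L]
variable {L' : Type w} [AddCommGroup L'] [Module F L'] [LieSuperalgebra F L']

theorem Iso.symm (h : Iso F L L') : Iso F L' L := by
  obtain ⟨e, he⟩ := h
  refine ⟨e.symm, fun i x hx => ?_, fun x y => ?_⟩
  · have h1 : e (proj F i (e.symm x)) = x := by
      have := he.map_proj i (e.symm x)
      simp only [LinearEquiv.coe_coe, LinearEquiv.apply_symm_apply] at this
      rw [this, proj_of_mem hx]
    have h2 : proj F i (e.symm x) = e.symm x := by rw [← e.symm_apply_apply (proj F i _), h1]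
    rw [LinearEquiv.coe_coe, ← h2]
    exact proj_mem F i _
  · have := he.2 (e.symm x) (e.symm y)
    simp only [LinearEquiv.coe_coe, LinearEquiv.apply_symm_apply] at this ⊢
    rw [← this, LinearEquiv.symm_apply_apply]

theorem IsHom.iso_of_injective [FiniteDimensional F L] {g : L' →ₗ[F] L} (hg : IsHom g)
    (hinj : Function.Injective g) (hdim : Module.finrank F L ≤ Module.finrank F L') :
    Iso F L L' := by
  have hfin : FiniteDimensional F L' := FiniteDimensional.of_injective g hinj
  have heq := le_antisymm (LinearMap.finrank_le_finrank_of_injective hinj) hdim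
  exact Iso.symm ⟨LinearMap.linearEquivOfInjective g hinj heq, hg⟩

theorem IsHom.coprod {A : Type*} [AddCommGroup A] [Module F A] [LieSuperalgebra F A]
    {B : Type*} [AddCommGroup B] [Module F B] [LieSuperalgebra F B]
    {f : A →ₗ[F] L} {g : B →ₗ[F] L} (hf : IsHom f) (hg : IsHom g)
    (hfg : ∀ a b, br (F := F) (f a) (g b) = 0) (hgf : ∀ a b, br (F := F) (g b) (f a) = 0) :
    IsHom (f.coprod g) := by
  refine ⟨fun i x hx => ?_, fun x y => ?_⟩
  · exact Submodule.add_mem _ (hf.1 i _ hx.1) (hg.1 i _ hx.2)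
  · have h : br (F := F) x y = (br (F := F) x.1 y.1, br (F := F) x.2 y.2) := rfl
    rw [h]
    simp only [LinearMap.coprod_apply, map_add, LinearMap.add_apply, hfg, hgf, hf.2, hg.2]
    abel

end Iso

/-! ### Maps out of the Heisenberg and abelian models. -/

section ModelMaps

variable {F : Type u} [Field F]
variable {L : Type v} [AddCommGroup L] [Module F L]

theorem br_H_eq {p q : ℕ} (x y : H F p q) : br (F := F) x y = heisZ (heisForm x y) := rfl

theorem heisForm_one_zero (x y : H F 1 0) : heisForm x y =
    (H.toProd F 1 0 x).1.1 0 * (H.toProd F 1 0 y).1.2.1 0 -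
      (H.toProd F 1 0 x).1.2.1 0 * (H.toProd F 1 0 y).1.1 0 := by
  simp [heisForm, dotProduct]

theorem heisForm_zero_one (x y : H F 0 1) : heisForm x y =
    (H.toProd F 0 1 x).2 0 * (H.toProd F 0 1 y).2 0 := by
  simp [heisForm, dotProduct]

variable (F) in
theorem finrank_H (p q : ℕ) : Module.finrank F (H F p q) = p + (p + 1) + q := by
  rw [(H.toProd F p q).finrank_eq]
  simp

variable (F) in
theorem finrank_Ab (m n : ℕ) : Module.finrank F (Ab F m n) = m + n := by
  rw [(Ab.toProd F m n).finrank_eq]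
  simp

instance (p q : ℕ) : FiniteDimensional F (H F p q) :=
  Module.Finite.equiv (H.toProd F p q).symm

instance (m n : ℕ) : FiniteDimensional F (Ab F m n) :=
  Module.Finite.equiv (Ab.toProd F m n).symm

/-- The linear map `H(1, 0) → L` with given images of the basis vectors. -/
def ofHeisEven (u v z : L) : H F 1 0 →ₗ[F] L where
  toFun x := (H.toProd F 1 0 x).1.1 0 • u + (H.toProd F 1 0 x).1.2.1 0 • v +
    (H.toProd F 1 0 x).1.2.2 • z
  map_add' x y := by simp only [map_add, Prod.fst_add, Prod.snd_add, Pi.add_apply, add_smul]; abel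
  map_smul' c x := by
    simp only [map_smul, Prod.smul_fst, Prod.smul_snd, Pi.smul_apply, smul_eq_mul, mul_smul,
      RingHom.id_apply, smul_add]

/-- The linear map `H(0, 1) → L` with given images of the basis vectors. -/
def ofHeisOdd (z w : L) : H F 0 1 →ₗ[F] L where
  toFun x := (H.toProd F 0 1 x).1.2.2 • z + (H.toProd F 0 1 x).2 0 • w
  map_add' x y := by simp only [map_add, Prod.fst_add, Prod.snd_add, Pi.add_apply, add_smul]; abel
  map_smul' c x := by
    simp only [map_smul, Prod.smul_fst, Prod.smul_snd, Pi.smul_apply, smul_eq_mul, mul_smul,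
      RingHom.id_apply, smul_add]

/-- The linear map `Ab(1, 0) → L` with given image of the basis vector. -/
def ofAbEven (w : L) : Ab F 1 0 →ₗ[F] L where
  toFun x := (Ab.toProd F 1 0 x).1 0 • w
  map_add' x y := by simp only [map_add, Prod.fst_add, Pi.add_apply, add_smul]
  map_smul' c x := by
    simp only [map_smul, Prod.smul_fst, Pi.smul_apply, smul_eq_mul, mul_smul, RingHom.id_apply]

/-- The linear map `Ab(0, 1) → L` with given image of the basis vector. -/
def ofAbOdd (w : L) : Ab F 0 1 →ₗ[F] L where
  toFun x := (Ab.toProd F 0 1 x).2 0 • w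
  map_add' x y := by simp only [map_add, Prod.snd_add, Pi.add_apply, add_smul]
  map_smul' c x := by
    simp only [map_smul, Prod.smul_snd, Pi.smul_apply, smul_eq_mul, mul_smul, RingHom.id_apply]

theorem ofHeisEven_apply (u v z : L) (x : H F 1 0) : ofHeisEven u v z x =
    (H.toProd F 1 0 x).1.1 0 • u + (H.toProd F 1 0 x).1.2.1 0 • v +
      (H.toProd F 1 0 x).1.2.2 • z := rfl

theorem ofHeisOdd_apply (z w : L) (x : H F 0 1) : ofHeisOdd z w x =
    (H.toProd F 0 1 x).1.2.2 • z + (H.toProd F 0 1 x).2 0 • w := rfl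

theorem ofAbEven_apply (w : L) (x : Ab F 1 0) :
    ofAbEven w x = (Ab.toProd F 1 0 x).1 0 • w := rfl

theorem ofAbOdd_apply (w : L) (x : Ab F 0 1) :
    ofAbOdd w x = (Ab.toProd F 0 1 x).2 0 • w := rfl

theorem injective_ofAbEven {w : L} (hw : w ≠ 0) :
    Function.Injective (ofAbEven w : Ab F 1 0 →ₗ[F] L) := by
  refine (injective_iff_map_eq_zero _).2 fun x hx => ?_
  have h0 := (smul_eq_zero.1 hx).resolve_right hw
  apply (Ab.toProd F 1 0).injective
  rw [map_zero]
  refine Prod.ext (funext fun i => ?_) (Subsingleton.elim _ _)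
  rw [Subsingleton.elim i 0]
  exact h0

theorem injective_ofAbOdd {w : L} (hw : w ≠ 0) :
    Function.Injective (ofAbOdd w : Ab F 0 1 →ₗ[F] L) := by
  refine (injective_iff_map_eq_zero _).2 fun x hx => ?_
  have h0 := (smul_eq_zero.1 hx).resolve_right hw
  apply (Ab.toProd F 0 1).injective
  rw [map_zero]
  refine Prod.ext (Subsingleton.elim _ _) (funext fun i => ?_)
  rw [Subsingleton.elim i 0]
  exact h0

variable [LieSuperalgebra F L]

theorem br_swap_of_even {u v : L} (hu : u ∈ part (F := F) 0) (hv : v ∈ part (F := F) 0) :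
    br (F := F) v u = -br (F := F) u v := by
  simpa using br_skew hv hu

theorem br_self_of_even [CharZero F] {u : L} (hu : u ∈ part (F := F) 0) :
    br (F := F) u u = 0 := by
  have h := br_swap_of_even hu hu
  have h2 : (2 : F) • br (F := F) u u = 0 := by
    rw [two_smul]
    nth_rewrite 1 [h]
    exact neg_add_cancel _
  exact (smul_eq_zero.1 h2).resolve_left two_ne_zero

theorem isHom_ofHeisEven [CharZero F] {u v z : L} (hu : u ∈ part (F := F) 0)
    (hv : v ∈ part (F := F) 0) (huv : br (F := F) u v = z) (hzc : z ∈ center F L) :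
    IsHom (ofHeisEven u v z : H F 1 0 →ₗ[F] L) := by
  have hz : z ∈ part (F := F) 0 := huv ▸ br_mem hu hv
  refine ⟨fun i x hx => ?_, fun x y => ?_⟩
  · rw [ofHeisEven_apply]
    rcases zmod_two_cases i with rfl | rfl
    · exact Submodule.add_mem _ (Submodule.add_mem _ (Submodule.smul_mem _ _ hu)
        (Submodule.smul_mem _ _ hv)) (Submodule.smul_mem _ _ hz)
    · have hx' : (H.toProd F 1 0 x).1 = 0 := (mem_prodPart_one _).1 hx
      rw [hx']
      simp
  · rw [br_H_eq]
    simp only [ofHeisEven_apply, map_add, map_smul, LinearMap.add_apply, LinearMap.smul_apply,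
      br_of_mem_center_left hzc, br_of_mem_center_right hzc, huv, br_swap_of_even hu hv,
      br_self_of_even hu, br_self_of_even hv, smul_zero, smul_neg, add_zero, zero_add]
    rw [heisForm_one_zero]
    simp only [heisZ, LinearEquiv.apply_symm_apply, Pi.zero_apply, zero_smul, zero_add,
      smul_smul, mul_comm, sub_eq_add_neg, add_smul, neg_smul, add_comm]

/-- Bracketing with `v` and with `u` reads off the coefficients of `u` and `v`; what is left is a
multiple of `z`. -/
theorem injective_ofHeisEven [CharZero F] {u v z : L} (hu : u ∈ part (F := F) 0)
    (hv : v ∈ part (F := F) 0) (huv : br (F := F) u v = z) (hzc : z ∈ center F L) (hz : z ≠ 0) :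
    Function.Injective (ofHeisEven u v z : H F 1 0 →ₗ[F] L) := by
  refine (injective_iff_map_eq_zero _).2 fun x hx => ?_
  rw [ofHeisEven_apply] at hx
  have h1 := congrArg (fun t => br (F := F) t v) hx
  have h2 := congrArg (fun t => br (F := F) u t) hx
  simp only [map_add, map_smul, LinearMap.add_apply, LinearMap.smul_apply, map_zero,
    LinearMap.zero_apply, br_of_mem_center_left hzc, br_of_mem_center_right hzc, huv,
    br_self_of_even hu, br_self_of_even hv, smul_zero, add_zero, zero_add] at h1 h2
  have e1 := (smul_eq_zero.1 h1).resolve_right hz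
  have e2 := (smul_eq_zero.1 h2).resolve_right hz
  rw [e1, e2, zero_smul, zero_smul, zero_add, zero_add] at hx
  have e3 := (smul_eq_zero.1 hx).resolve_right hz
  apply (H.toProd F 1 0).injective
  rw [map_zero]
  refine Prod.ext (Prod.ext (funext fun i => ?_) (Prod.ext (funext fun i => ?_) e3))
    (Subsingleton.elim _ _)
  · rw [Subsingleton.elim i 0]; exact e1
  · rw [Subsingleton.elim i 0]; exact e2

theorem isHom_ofHeisOdd {z w : L} (hw : w ∈ part (F := F) 1) (hww : br (F := F) w w = z)
    (hzc : z ∈ center F L) : IsHom (ofHeisOdd z w : H F 0 1 →ₗ[F] L) := by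
  have hz : z ∈ part (F := F) 0 := hww ▸ br_mem hw hw
  refine ⟨fun i x hx => ?_, fun x y => ?_⟩
  · rw [ofHeisOdd_apply]
    rcases zmod_two_cases i with rfl | rfl
    · have hx' : (H.toProd F 0 1 x).2 = 0 := (mem_prodPart_zero _).1 hx
      rw [hx', Pi.zero_apply, zero_smul, add_zero]
      exact Submodule.smul_mem _ _ hz
    · have hx' : (H.toProd F 0 1 x).1 = 0 := (mem_prodPart_one _).1 hx
      rw [hx', Prod.snd_zero, Prod.snd_zero, zero_smul, zero_add]
      exact Submodule.smul_mem _ _ hw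
  · rw [br_H_eq]
    simp only [ofHeisOdd_apply, map_add, map_smul, LinearMap.add_apply, LinearMap.smul_apply,
      br_of_mem_center_left hzc, br_of_mem_center_right hzc, hww, smul_zero, add_zero, zero_add]
    rw [heisForm_zero_one]
    simp only [heisZ, LinearEquiv.apply_symm_apply, Pi.zero_apply, zero_smul, add_zero,
      smul_smul, mul_comm]

theorem injective_ofHeisOdd {z w : L} (hww : br (F := F) w w = z)
    (hzc : z ∈ center F L) (hz : z ≠ 0) :
    Function.Injective (ofHeisOdd z w : H F 0 1 →ₗ[F] L) := by
  refine (injective_iff_map_eq_zero _).2 fun x hx => ?_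
  rw [ofHeisOdd_apply] at hx
  have h1 := congrArg (fun t => br (F := F) t w) hx
  simp only [map_add, map_smul, LinearMap.add_apply, LinearMap.smul_apply, map_zero,
    LinearMap.zero_apply, br_of_mem_center_left hzc, hww, smul_zero, zero_add] at h1
  have e1 := (smul_eq_zero.1 h1).resolve_right hz
  rw [e1, zero_smul, add_zero] at hx
  have e2 := (smul_eq_zero.1 hx).resolve_right hz
  apply (H.toProd F 0 1).injective
  rw [map_zero]
  refine Prod.ext (Prod.ext (Subsingleton.elim _ _) (Prod.ext (Subsingleton.elim _ _) e2))
    (funext fun i => ?_)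
  rw [Subsingleton.elim i 0]
  exact e1

theorem isHom_ofAbEven [CharZero F] {w : L} (hw : w ∈ part (F := F) 0) :
    IsHom (ofAbEven w : Ab F 1 0 →ₗ[F] L) := by
  refine ⟨fun i x hx => ?_, fun x y => ?_⟩
  · rw [ofAbEven_apply]
    rcases zmod_two_cases i with rfl | rfl
    · exact Submodule.smul_mem _ _ hw
    · have hx' : (Ab.toProd F 1 0 x).1 = 0 := (mem_prodPart_one _).1 hx
      rw [hx', Pi.zero_apply, zero_smul]
      exact Submodule.zero_mem _
  · have h : br (F := F) x y = 0 := rfl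
    rw [h, map_zero, ofAbEven_apply, ofAbEven_apply, map_smul, map_smul, LinearMap.smul_apply,
      br_self_of_even hw, smul_zero, smul_zero]

theorem isHom_ofAbOdd {w : L} (hw : w ∈ part (F := F) 1) (hww : br (F := F) w w = 0) :
    IsHom (ofAbOdd w : Ab F 0 1 →ₗ[F] L) := by
  refine ⟨fun i x hx => ?_, fun x y => ?_⟩
  · rw [ofAbOdd_apply]
    rcases zmod_two_cases i with rfl | rfl
    · have hx' : (Ab.toProd F 0 1 x).2 = 0 := (mem_prodPart_zero _).1 hx
      rw [hx', Pi.zero_apply, zero_smul]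
      exact Submodule.zero_mem _
    · exact Submodule.smul_mem _ _ hw
  · have h : br (F := F) x y = 0 := rfl
    rw [h, map_zero, ofAbOdd_apply, ofAbOdd_apply, map_smul, map_smul, LinearMap.smul_apply,
      hww, smul_zero, smul_zero]

end ModelMaps

/-! ### Adding one line to an injective map. -/

section LinearAlgebra

variable {F : Type u} [Field F] {V : Type v} [AddCommGroup V] [Module F V]
variable {A B : Type*} [AddCommGroup A] [Module F A] [AddCommGroup B] [Module F B]

theorem injective_coprod_of_range_le_span {f : A →ₗ[F] V} {g : B →ₗ[F] V} {w : V}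
    (hf : Function.Injective f) (hg : Function.Injective g)
    (hgw : LinearMap.range g ≤ F ∙ w) (hw : w ∉ LinearMap.range f) :
    Function.Injective (f.coprod g) := by
  refine (injective_iff_map_eq_zero _).2 fun x hx => ?_
  rw [LinearMap.coprod_apply] at hx
  obtain ⟨k, hk⟩ := Submodule.mem_span_singleton.1 (hgw ⟨x.2, rfl⟩)
  have hk0 : k = 0 := by
    by_contra hk0
    refine hw ⟨-(k⁻¹ • x.1), ?_⟩
    rw [map_neg, map_smul, eq_neg_of_add_eq_zero_left hx, ← hk, smul_neg, neg_neg, smul_smul,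
      inv_mul_cancel₀ hk0, one_smul]
  rw [hk0, zero_smul] at hk
  rw [← hk, add_zero] at hx
  exact Prod.ext ((injective_iff_map_eq_zero _).1 hf _ hx)
    ((injective_iff_map_eq_zero _).1 hg _ hk.symm)

end LinearAlgebra

/-! ### Classification of nilpotent superalgebras with multiplier-rank at most two. -/

section Classification

variable {F : Type u} [Field F]
variable {L : Type v} [AddCommGroup L] [Module F L] [LieSuperalgebra F L]

theorem derived_eq_span_br {c x y : L} (hd : derived F L = F ∙ c) (h : br (F := F) x y ≠ 0) :
    derived F L = F ∙ br (F := F) x y := by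
  have hmem := br_mem_derived (F := F) x y
  rw [hd] at hmem ⊢
  obtain ⟨k, hk⟩ := Submodule.mem_span_singleton.1 hmem
  have hk0 : k ≠ 0 := by
    rintro rfl
    rw [zero_smul] at hk
    exact h hk.symm
  rw [← hk, Submodule.span_singleton_smul_eq (IsUnit.mk0 k hk0)]

variable [CharZero F] [FiniteDimensional F L]

/-- The subalgebra spanned by `w` and `[w, w]` is a copy of `H(0,1)`, and `dim L ≤ 2` leaves room
for nothing else. -/
theorem iso_of_odd_bracket
    (hcod : Module.finrank F (skewForms F L) ≤ Module.finrank F (cocycles F L) + 1)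
    {w : L} (hw : w ∈ part (F := F) 1) (hww : br (F := F) w w ≠ 0)
    (hzc : br (F := F) w w ∈ center F L) (hd : derived F L = F ∙ br (F := F) w w) :
    Iso F L (H F 0 1) := by
  refine (isHom_ofHeisOdd hw rfl hzc).iso_of_injective (injective_ofHeisOdd rfl hzc hww) ?_
  rw [finrank_H]
  exact finrank_le_two_of_odd_bracket hcod hw rfl hww hd

/-- A copy of `H(1,0)` embeds and `dim L ≤ 4`, so at most one further homogeneous vector is needed;
its parity decides between the two direct sums. -/
theorem iso_of_even_bracket
    (hcod : Module.finrank F (skewForms F L) ≤ Module.finrank F (cocycles F L) + 1)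
    {u v : L} (hu : u ∈ part (F := F) 0) (hv : v ∈ part (F := F) 0)
    (huv : br (F := F) u v ≠ 0) (hzc : br (F := F) u v ∈ center F L)
    (hd : derived F L = F ∙ br (F := F) u v) :
    Iso F L (H F 1 0) ∨ Iso F L (H F 1 0 × Ab F 1 0) ∨ Iso F L (H F 1 0 × Ab F 0 1) := by
  have hz : br (F := F) u v ∈ part (F := F) 0 := br_mem hu hv
  have hg := isHom_ofHeisEven hu hv rfl hzc
  have hinj := injective_ofHeisEven hu hv rfl hzc huv
  have hdim := finrank_le_four_of_even_bracket hcod hu hv rfl huv hd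
  have hspan : ∀ x y : L, ∃ k : F, k • br (F := F) u v = br (F := F) x y := fun x y => by
    have := br_mem_derived (F := F) x y
    rw [hd] at this
    exact Submodule.mem_span_singleton.1 this
  set g : H F 1 0 →ₗ[F] L := ofHeisEven u v (br (F := F) u v) with hgdef
  have hrange : ∀ a b c : F, a • u + b • v + c • br (F := F) u v ∈ LinearMap.range g :=
    fun a b c => ⟨(H.toProd F 1 0).symm ((fun _ => a, fun _ => b, c), 0), by
      rw [hgdef, ofHeisEven_apply, LinearEquiv.apply_symm_apply]⟩
  have hcomm : ∀ w : L, br (F := F) u w = 0 → br (F := F) v w = 0 → ∀ x,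
      br (F := F) (g x) w = 0 := by
    intro w h1 h2 x
    rw [hgdef, ofHeisEven_apply]
    simp [h1, h2, br_of_mem_center_left hzc]
  have hcomm' : ∀ w : L, br (F := F) w u = 0 → br (F := F) w v = 0 → ∀ x,
      br (F := F) w (g x) = 0 := by
    intro w h1 h2 x
    rw [hgdef, ofHeisEven_apply]
    simp [h1, h2, br_of_mem_center_right hzc]
  by_cases hle : Module.finrank F L ≤ 3
  · left
    refine hg.iso_of_injective hinj ?_
    rwa [finrank_H]
  right
  have hex : ∃ i, ∃ w ∈ part (F := F) (L := L) i, w ∉ LinearMap.range g := by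
    by_contra! hall
    apply hle
    have htop : LinearMap.range g = ⊤ := by
      rw [eq_top_iff]
      intro x _
      rw [← proj_zero_add_proj_one F x]
      exact Submodule.add_mem _ (hall 0 _ (proj_mem F 0 x)) (hall 1 _ (proj_mem F 1 x))
    have h := LinearMap.finrank_range_of_inj hinj
    rw [htop, finrank_top, finrank_H] at h
    omega
  obtain ⟨i, w, hw, hwg⟩ := hex
  rcases zmod_two_cases i with rfl | rfl
  · left
    -- With `[w, v] = a z` and `[u, w] = b z`, subtracting `a u + b v` from `w` makes it commute
    -- with `u` and `v`.
    obtain ⟨a, ha⟩ := hspan w v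
    obtain ⟨b, hb⟩ := hspan u w
    set w' := w - (a • u + b • v + (0 : F) • br (F := F) u v) with hw'
    have hw'0 : w' ∈ part (F := F) 0 := by
      rw [hw', zero_smul, add_zero]
      exact Submodule.sub_mem _ hw (Submodule.add_mem _ (Submodule.smul_mem _ _ hu)
        (Submodule.smul_mem _ _ hv))
    have hw'g : w' ∉ LinearMap.range g := fun h => hwg (by
      have := Submodule.add_mem _ h (hrange a b 0)
      rwa [hw', sub_add_cancel] at this)
    have hvw : br (F := F) w' v = 0 := by
      rw [hw']
      simp [← ha, br_self_of_even hv]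
    have huw : br (F := F) u w' = 0 := by
      rw [hw']
      simp [← hb, br_self_of_even hu]
    have hvw' : br (F := F) v w' = 0 := by rw [br_swap_of_even hw'0 hv, hvw, neg_zero]
    have huw' : br (F := F) w' u = 0 := by rw [br_swap_of_even hu hw'0, huw, neg_zero]
    have hw'ne : w' ≠ 0 := fun h => hw'g (h ▸ Submodule.zero_mem _)
    refine (hg.coprod (isHom_ofAbEven hw'0) (fun x y => ?_)
      fun x y => ?_).iso_of_injective
      (injective_coprod_of_range_le_span hinj (injective_ofAbEven hw'ne) ?_ hw'g) ?_
    · rw [ofAbEven_apply, map_smul, hcomm w' huw hvw', smul_zero]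
    · rw [ofAbEven_apply, map_smul, LinearMap.smul_apply, hcomm' w' huw' hvw, smul_zero]
    · rintro _ ⟨x, rfl⟩
      exact Submodule.mem_span_singleton.2 ⟨_, rfl⟩
    · rw [Module.finrank_prod, finrank_H, finrank_Ab]
      exact hdim
  · right
    -- An odd `w` needs no correction: its brackets with even elements are odd, but `L²` is an even
    -- line.
    have hodd : ∀ x ∈ part (F := F) (L := L) 0, br (F := F) x w = 0 := fun x hx => by
      obtain ⟨k, hk⟩ := hspan x w
      refine eq_zero_of_mem_part_of_mem_part (i := 0) (j := 0 + 1) (by decide) ?_ (br_mem hx hw)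
      rw [← hk]
      exact Submodule.smul_mem _ _ hz
    have hodd' : ∀ x ∈ part (F := F) (L := L) 0, br (F := F) w x = 0 := fun x hx => by
      rw [br_skew hw hx, hodd x hx]
      simp
    -- A nonzero `[w, w]` would force `dim L ≤ 2`, whereas here `dim L > 3`.
    have hww : br (F := F) w w = 0 := by
      by_contra hne
      have := finrank_le_two_of_odd_bracket hcod hw rfl hne (derived_eq_span_br hd hne)
      omega
    have hwne : w ≠ 0 := fun h => hwg (h ▸ Submodule.zero_mem _)
    refine (hg.coprod (isHom_ofAbOdd hw hww) (fun x y => ?_)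
      fun x y => ?_).iso_of_injective
      (injective_coprod_of_range_le_span hinj (injective_ofAbOdd hwne) ?_ hwg) ?_
    · rw [ofAbOdd_apply, map_smul, hcomm w (hodd u hu) (hodd v hv), smul_zero]
    · rw [ofAbOdd_apply, map_smul, LinearMap.smul_apply, hcomm' w (hodd' u hu) (hodd' v hv),
        smul_zero]
    · rintro _ ⟨x, rfl⟩
      exact Submodule.mem_span_singleton.2 ⟨_, rfl⟩
    · rw [Module.finrank_prod, finrank_H, finrank_Ab]
      exact hdim

theorem Nilpotent.iso_of_mr_le_two (hn : Nilpotent F L) (hmr : mr F L ≤ 2)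
    (hna : ¬Abelian F L) :
    Iso F L (H F 1 0) ∨ Iso F L (H F 1 0 × Ab F 1 0) ∨
      Iso F L (H F 1 0 × Ab F 0 1) ∨ Iso F L (H F 0 1) := by
  obtain ⟨i, c, hc, hc0, hcd, hcc⟩ := hn.exists_homogeneous_mem_center hna
  have hd := derived_eq_span_of_mr_le_two hmr hc hc0 hcd hcc
  have hcod := finrank_skewForms_le_of_mr_le_two hmr hna
  have hcen : ∀ x y : L, br (F := F) x y ∈ center F L := fun x y => by
    have := br_mem_derived (F := F) x y
    rw [hd] at this
    exact (Submodule.span_singleton_le_iff_mem _ _).2 hcc this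
  have hpart : ∀ x y : L, br (F := F) x y ∈ part (F := F) i := fun x y => by
    have := br_mem_derived (F := F) x y
    rw [hd] at this
    exact (Submodule.span_singleton_le_iff_mem _ _).2 hc this
  have hzero : ∀ a b, a + b ≠ i → ∀ x ∈ part (F := F) (L := L) a,
      ∀ y ∈ part (F := F) (L := L) b, br (F := F) x y = 0 := fun a b hab x hx y hy =>
    eq_zero_of_mem_part_of_mem_part hab (br_mem hx hy) (hpart x y)
  by_contra hcon
  push Not at hcon
  obtain ⟨h1, h2, h3, h4⟩ := hcon
  apply hna
  rw [abelian_iff_br_eq_zero_of_homogeneous]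
  rcases zmod_two_cases i with rfl | rfl
  · have hself : ∀ w ∈ part (F := F) (L := L) 1, br (F := F) w w = 0 := fun w hw => by
      by_contra hww
      exact h4 (iso_of_odd_bracket hcod hw hww (hcen w w) (derived_eq_span_br hd hww))
    intro a b x hx y hy
    rcases zmod_two_cases a with rfl | rfl <;> rcases zmod_two_cases b with rfl | rfl
    · by_contra hxy
      rcases iso_of_even_bracket hcod hx hy hxy (hcen x y) (derived_eq_span_br hd hxy) with
        h | h | h
      exacts [h1 h, h2 h, h3 h]
    · exact hzero 0 1 (by decide) x hx y hy
    · exact hzero 1 0 (by decide) x hx y hy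
    -- Polarization: on odd elements the bracket is symmetric, so vanishing squares force it to
    -- vanish.
    · have hxy := hself (x + y) (Submodule.add_mem _ hx hy)
      rw [map_add, map_add, LinearMap.add_apply, LinearMap.add_apply, hself x hx, hself y hy, zero_add,
        add_zero, br_skew hy hx] at hxy
      simp only [ZMod.val_one, mul_one, pow_one, neg_smul, one_smul, neg_neg] at hxy
      rw [← two_smul F] at hxy
      exact (smul_eq_zero.1 hxy).resolve_left two_ne_zero
  · have heo : ∀ x ∈ part (F := F) (L := L) 0, ∀ y ∈ part (F := F) (L := L) 1,
        br (F := F) x y = 0 := fun x hx y hy => by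
      by_contra hxy
      have := finrank_cocycles_add_two_le_of_odd_derived hx hy rfl hxy (hcen x y)
        (derived_eq_span_br hd hxy)
      omega
    intro a b x hx y hy
    rcases zmod_two_cases a with rfl | rfl <;> rcases zmod_two_cases b with rfl | rfl
    · exact hzero 0 0 (by decide) x hx y hy
    · exact heo x hx y hy
    · rw [br_skew hx hy, heo y hy x hx]
      simp
    · exact hzero 1 1 (by decide) x hx y hy

end Classification

/-! ### Isomorphism invariance of `smr` and nilpotency. -/

section Invariance

variable {F : Type u} [Field F]
variable {L : Type v} [AddCommGroup L] [Module F L]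
variable {L' : Type w} [AddCommGroup L'] [Module F L']

theorem finrank_le_of_compl₁₂_mem [FiniteDimensional F L] (e : L ≃ₗ[F] L')
    {S : Submodule F (L →ₗ[F] L →ₗ[F] F)} {S' : Submodule F (L' →ₗ[F] L' →ₗ[F] F)}
    (h : ∀ β ∈ S', β.compl₁₂ (e : L →ₗ[F] L') (e : L →ₗ[F] L') ∈ S) :
    Module.finrank F S' ≤ Module.finrank F S := by
  let P : S' →ₗ[F] (L →ₗ[F] L →ₗ[F] F) :=
    { toFun := fun β => β.1.compl₁₂ (e : L →ₗ[F] L') (e : L →ₗ[F] L')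
      map_add' := fun _ _ => rfl
      map_smul' := fun _ _ => rfl }
  have hPapply : ∀ β x y, P β x y = β.1 (e x) (e y) := fun _ _ _ => rfl
  have hP := finrank_add_finrank_le_of_map_mem (V := S') (X := L →ₗ[F] L →ₗ[F] F) P (A := ⊥)
    bot_le (fun β => h β.1 β.2) (fun β hβ => by
      apply Subtype.ext
      ext x y
      have := LinearMap.congr_fun₂ ((Submodule.mem_bot F).1 hβ) (e.symm x) (e.symm y)
      simpa [hPapply] using this)
  exact le_trans (Nat.le_add_right _ _) hP

variable [LieSuperalgebra F L] [LieSuperalgebra F L']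

theorem IsHom.compl₁₂_mem_skewForms {f : L →ₗ[F] L'} (hf : IsHom f)
    {β : L' →ₗ[F] L' →ₗ[F] F} (hβ : β ∈ skewForms F L') : β.compl₁₂ f f ∈ skewForms F L :=
  fun i j x hx y hy => hβ i j _ (hf.1 i x hx) _ (hf.1 j y hy)

theorem IsHom.compl₁₂_mem_parityForms {f : L →ₗ[F] L'} (hf : IsHom f) {i : ZMod 2}
    {β : L' →ₗ[F] L' →ₗ[F] F} (hβ : β ∈ parityForms F L' i) :
    β.compl₁₂ f f ∈ parityForms F L i :=
  fun a b hab x hx y hy => hβ a b hab _ (hf.1 a x hx) _ (hf.1 b y hy)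

theorem IsHom.compl₁₂_mem_cocycles {f : L →ₗ[F] L'} (hf : IsHom f)
    {β : L' →ₗ[F] L' →ₗ[F] F} (hβ : β ∈ cocycles F L') : β.compl₁₂ f f ∈ cocycles F L := by
  refine ⟨hf.compl₁₂_mem_skewForms hβ.1, fun i j x hx y hy z => ?_⟩
  simp only [LinearMap.compl₁₂_apply, hf.2]
  exact hβ.2 i j _ (hf.1 i x hx) _ (hf.1 j y hy) _

theorem IsHom.compl₁₂_mem_coboundaries {f : L →ₗ[F] L'} (hf : IsHom f)
    {β : L' →ₗ[F] L' →ₗ[F] F} (hβ : β ∈ coboundaries F L') :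
    β.compl₁₂ f f ∈ coboundaries F L := by
  obtain ⟨l, rfl⟩ := hβ
  refine ⟨l ∘ₗ f, ?_⟩
  ext x y
  simp only [LinearMap.compl₁₂_apply, coboundary_apply, LinearMap.comp_apply, hf.2]

theorem Iso.nilpotent (h : Iso F L L')
    (h' : ∀ x y z : L', br (F := F) x (br (F := F) y z) = 0) : Nilpotent F L := by
  obtain ⟨e, he⟩ := h
  refine nilpotent_of_br_br_eq_zero fun x y z => e.injective ?_
  have h1 := he.2 x (br (F := F) y z)
  have h2 := he.2 y z
  simp only [LinearEquiv.coe_coe] at h1 h2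
  rw [h1, h2, h', map_zero]

variable [FiniteDimensional F L] [FiniteDimensional F L'] [CharZero F]

theorem Iso.smr_eq (h : Iso F L L') : smr F L = smr F L' := by
  obtain ⟨e', he'⟩ := h.symm
  obtain ⟨e, he⟩ := h
  have h1 : ∀ i, Module.finrank F (skewForms F L ⊓ parityForms F L i : Submodule F _) =
      Module.finrank F (skewForms F L' ⊓ parityForms F L' i : Submodule F _) := fun i =>
    le_antisymm
      (finrank_le_of_compl₁₂_mem e' fun β hβ =>
        ⟨he'.compl₁₂_mem_skewForms hβ.1, he'.compl₁₂_mem_parityForms hβ.2⟩)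
      (finrank_le_of_compl₁₂_mem e fun β hβ =>
        ⟨he.compl₁₂_mem_skewForms hβ.1, he.compl₁₂_mem_parityForms hβ.2⟩)
  have h2 : ∀ i, Module.finrank F (cocycles F L ⊓ parityForms F L i : Submodule F _) =
      Module.finrank F (cocycles F L' ⊓ parityForms F L' i : Submodule F _) := fun i =>
    le_antisymm
      (finrank_le_of_compl₁₂_mem e' fun β hβ =>
        ⟨he'.compl₁₂_mem_cocycles hβ.1, he'.compl₁₂_mem_parityForms hβ.2⟩)
      (finrank_le_of_compl₁₂_mem e fun β hβ =>
        ⟨he.compl₁₂_mem_cocycles hβ.1, he.compl₁₂_mem_parityForms hβ.2⟩)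
  have h3 : ∀ i, Module.finrank F (coboundaries F L ⊓ parityForms F L i : Submodule F _) =
      Module.finrank F (coboundaries F L' ⊓ parityForms F L' i : Submodule F _) := fun i =>
    le_antisymm
      (finrank_le_of_compl₁₂_mem e' fun β hβ =>
        ⟨he'.compl₁₂_mem_coboundaries hβ.1, he'.compl₁₂_mem_parityForms hβ.2⟩)
      (finrank_le_of_compl₁₂_mem e fun β hβ =>
        ⟨he.compl₁₂_mem_coboundaries hβ.1, he.compl₁₂_mem_parityForms hβ.2⟩)
  rw [LieSuperalgebra.smr_eq, LieSuperalgebra.smr_eq, h1, h1, h2, h2, h3, h3]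

end Invariance

/-! ### Values of `smr` from an explicit description of the cocycles. -/

section Values

variable {F : Type u} [Field F]
variable {L : Type v} [AddCommGroup L] [Module F L] [FiniteDimensional F L] [LieSuperalgebra F L]

theorem finrank_coboundaries_of_even {z : L} (hz : z ∈ part (F := F) 0) (hz0 : z ≠ 0)
    (hd : derived F L = F ∙ z) :
    Module.finrank F (coboundaries F L ⊓ parityForms F L 0 : Submodule F _) = 1 ∧
      Module.finrank F (coboundaries F L ⊓ parityForms F L 1 : Submodule F _) = 0 := by
  have htot := finrank_coboundaries F L
  rw [hd, finrank_span_singleton hz0] at htot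
  have hle : coboundaries F L ≤ parityForms F L 0 := by
    rintro _ ⟨l, rfl⟩ a b hab x hx y hy
    have h1 := br_mem_derived (F := F) x y
    rw [hd] at h1
    have h2 := (Submodule.span_singleton_le_iff_mem _ _).2 hz h1
    rw [coboundary_apply, eq_zero_of_mem_part_of_mem_part hab (br_mem hx hy) h2, map_zero]
  have hsum := finrank_eq_add_finrank_inf_parityForms (coboundaries F L)
    fun _ h i => formProj_mem_coboundaries h i
  rw [inf_eq_left.2 hle] at hsum ⊢
  omega

/-- Being a cocycle is the single linear condition `β z w = 0`, which sees only the part of `β` of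
parity `i`. The form `ζ ∧ l` dual to `(z, w)` violates it, so the codimension is exactly one. -/
theorem finrank_skewForms_eq_succ {z w : L} {i : ZMod 2} (hz : z ∈ part (F := F) 0)
    (hz0 : z ≠ 0) (hw : w ∈ part (F := F) i) (hwz : w ∉ F ∙ z)
    (hZ : ∀ β ∈ skewForms F L, β ∈ cocycles F L ↔ β z w = 0) :
    Module.finrank F (skewForms F L ⊓ parityForms F L i : Submodule F _) =
      Module.finrank F (cocycles F L ⊓ parityForms F L i : Submodule F _) + 1 := by
  obtain ⟨ζ, hζz, hζ⟩ := exists_homogeneous_dual_of_ne_zero hz hz0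
  obtain ⟨l, hlw, hlz, hl⟩ := exists_homogeneous_dual hw (S := F ∙ z) (fun x hx => by
    have hx0 := (Submodule.span_singleton_le_iff_mem _ _).2 hz hx
    by_cases h : (0 : ZMod 2) = i
    · subst h; rwa [proj_of_mem hx0]
    · rw [proj_of_mem_of_ne hx0 h]; exact Submodule.zero_mem _) hwz
  have hlz : l z = 0 := hlz z (Submodule.mem_span_singleton_self z)
  set β₀ := twoForm (-1) ζ l with hβ₀
  have hval : β₀ z w = 1 := by rw [hβ₀, twoForm_apply, hζz, hlw, hlz]; simp
  have hskew : β₀ ∈ skewForms F L := twoForm_mem_skewForms_of_even (hζ 1 one_ne_zero) l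
  have hpar : β₀ ∈ parityForms F L i := by
    intro a b hab x hx y hy
    rw [hβ₀, twoForm_apply]
    have h1 : ζ x * l y = 0 := by
      by_cases ha : a = 0
      · have hb : b ≠ i := by rintro rfl; exact hab (by rw [ha, zero_add])
        rw [hl b hb y hy, mul_zero]
      · rw [hζ a ha x hx, zero_mul]
    have h2 : l x * ζ y = 0 := by
      by_cases hb : b = 0
      · have ha : a ≠ i := by rintro rfl; exact hab (by rw [hb, add_zero])
        rw [hl a ha x hx, zero_mul]
      · rw [hζ b hb y hy, mul_zero]
    rw [h1, h2, mul_zero, add_zero]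
  refine le_antisymm ?_ ?_
  · have hle : skewForms F L ⊓ parityForms F L i ≤
        (cocycles F L ⊓ parityForms F L i) ⊔ Submodule.span F {β₀} := by
      rintro β ⟨hβs, hβp⟩
      have hs : β + -β z w • β₀ ∈ skewForms F L :=
        Submodule.add_mem _ hβs (Submodule.smul_mem _ _ hskew)
      have hp : β + -β z w • β₀ ∈ parityForms F L i :=
        Submodule.add_mem _ hβp (Submodule.smul_mem _ _ hpar)
      refine Submodule.mem_sup.2 ⟨β + -β z w • β₀, ⟨(hZ _ hs).2 ?_, hp⟩, β z w • β₀,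
        Submodule.mem_span_singleton.2 ⟨_, rfl⟩, ?_⟩
      · simp [hval]
      · ext x y
        simp
    have hβ₀0 : β₀ ≠ 0 := by
      intro h
      rw [h] at hval
      exact zero_ne_one hval
    refine (Submodule.finrank_mono (M := L →ₗ[F] L →ₗ[F] F) hle).trans ?_
    refine (Submodule.finrank_add_le_finrank_add_finrank (V := L →ₗ[F] L →ₗ[F] F) _ _).trans ?_
    rw [finrank_span_singleton (V := L →ₗ[F] L →ₗ[F] F) hβ₀0]
  · have h := finrank_add_finrank_le_of_map_mem (V := F) (X := L →ₗ[F] L →ₗ[F] F)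
      (LinearMap.toSpanSingleton F _ β₀)
      (inf_le_inf_right (parityForms F L i) (cocycles_le_skewForms (F := F) (L := L)))
      (fun a => ⟨Submodule.smul_mem _ _ hskew, Submodule.smul_mem _ _ hpar⟩)
      (fun a ha => by
        have h0 := (hZ _ ha.1.1).1 ha.1
        rw [LinearMap.toSpanSingleton_apply, LinearMap.smul_apply, LinearMap.smul_apply, hval,
          smul_eq_mul, mul_one] at h0
        exact h0)
    rw [Module.finrank_self] at h
    omega

variable [CharZero F]

theorem Abelian.smr_eq (h : Abelian F L) : smr F L = (0, 0) := by
  have hZ : cocycles F L = skewForms F L := by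
    refine le_antisymm cocycles_le_skewForms fun β hβ => ⟨hβ, fun i j x _ y _ z => ?_⟩
    rw [h, h, h]
    simp
  have hC : coboundaries F L = ⊥ := by
    rw [eq_bot_iff]
    rintro _ ⟨l, rfl⟩
    refine (Submodule.mem_bot F).2 ?_
    ext x y
    rw [coboundary_apply, h, map_zero]
    rfl
  rw [LieSuperalgebra.smr_eq, hZ, hC, bot_inf_eq, bot_inf_eq, finrank_bot]
  simp

/-- Both contributions to `mr` are nonnegative, so `mr = 0` already forces `L² = 0`. -/
theorem smr_eq_zero_iff : smr F L = (0, 0) ↔ Abelian F L := by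
  refine ⟨fun h => ?_, Abelian.smr_eq⟩
  have hmr : mr F L = 0 := by rw [mr, h]; rfl
  rw [mr_eq] at hmr
  have hle := Submodule.finrank_mono (M := L →ₗ[F] L →ₗ[F] F)
    (cocycles_le_skewForms (F := F) (L := L))
  rw [abelian_iff_derived_eq_bot, ← Submodule.finrank_eq_zero]
  omega

theorem smr_of_cocycles_eq {z : L} (hz : z ∈ part (F := F) 0) (hz0 : z ≠ 0)
    (hd : derived F L = F ∙ z) (hZ : ∀ β ∈ skewForms F L, β ∈ cocycles F L) :
    smr F L = (1, 0) := by
  obtain ⟨h0, h1⟩ := finrank_coboundaries_of_even hz hz0 hd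
  rw [smr_eq, h0, h1, le_antisymm (cocycles_le_skewForms (F := F) (L := L)) hZ]
  simp

theorem smr_of_mem_cocycles_iff {z w : L} {i : ZMod 2} (hz : z ∈ part (F := F) 0)
    (hz0 : z ≠ 0) (hd : derived F L = F ∙ z) (hw : w ∈ part (F := F) i) (hwz : w ∉ F ∙ z)
    (hZ : ∀ β ∈ skewForms F L, β ∈ cocycles F L ↔ β z w = 0) :
    smr F L = if i = 0 then (2, 0) else (1, 1) := by
  obtain ⟨h0, h1⟩ := finrank_coboundaries_of_even hz hz0 hd
  have hsucc := finrank_skewForms_eq_succ hz hz0 hw hwz hZ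
  have hne : ∀ j, i ≠ j → cocycles F L ⊓ parityForms F L j = skewForms F L ⊓ parityForms F L j := by
    refine fun j hij => le_antisymm (inf_le_inf_right _ cocycles_le_skewForms) ?_
    rintro β ⟨hβs, hβp⟩
    exact ⟨(hZ β hβs).2 (hβp 0 i (by rwa [zero_add]) z hz w hw), hβp⟩
  rw [smr_eq, h0, h1]
  rcases zmod_two_cases i with rfl | rfl
  · rw [hsucc, hne 1 zero_ne_one]
    simp
  · rw [hsucc, hne 0 one_ne_zero]
    simp

end Values

/-! ### Computation of `smr` for the models. -/

section Models

variable {F : Type u} [Field F]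

section Heisenberg

variable {L : Type v} [AddCommGroup L] [Module F L] [LieSuperalgebra F L]

theorem skewForm_swap_of_even {β : L →ₗ[F] L →ₗ[F] F} (hβ : β ∈ skewForms F L) {z : L}
    (hz : z ∈ part (F := F) 0) (x : L) : β x z = -β z x := by
  refine part_induction (F := F) (p := fun x => β x z = -β z x) (fun i x hx => ?_)
    (fun x y hx hy => ?_) x
  · simpa using hβ i 0 x hx z hz
  · rw [map_add, LinearMap.add_apply, hx, hy, map_add, neg_add]

theorem skewForm_self_of_even [CharZero F] {β : L →ₗ[F] L →ₗ[F] F} (hβ : β ∈ skewForms F L)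
    {z : L} (hz : z ∈ part (F := F) 0) : β z z = 0 := by
  have h := skewForm_swap_of_even hβ hz z
  have h2 : (2 : F) * β z z = 0 := by linear_combination h
  simpa using h2

theorem derived_eq_span_of_forall {z u v : L} (huv : br (F := F) u v = z)
    (h : ∀ x y : L, br (F := F) x y ∈ F ∙ z) : derived F L = F ∙ z := by
  refine le_antisymm ?_ ((Submodule.span_singleton_le_iff_mem _ _).2 (huv ▸ br_mem_derived u v))
  rw [derived, Submodule.map₂_le]
  exact fun x _ y _ => h x y

/-- With bracket `(a ∧ b) z`, the cocycle identity says `a ∧ b ∧ β(z, ·) = 0`, which is automatic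
when `β(z, ·)` is a combination of `a` and `b`. -/
theorem mem_cocycles_of_even_heisenberg {z : L} (hz : z ∈ part (F := F) 0)
    {a b : Module.Dual F L} (ha : ∀ x ∈ part (F := F) (L := L) 1, a x = 0)
    (hb : ∀ x ∈ part (F := F) (L := L) 1, b x = 0)
    (hbr : ∀ x y : L, br (F := F) x y = (a x * b y - b x * a y) • z)
    {β : L →ₗ[F] L →ₗ[F] F} (hβ : β ∈ skewForms F L) {p q : F}
    (hβz : ∀ x, β z x = a x * p + b x * q) : β ∈ cocycles F L := by
  refine ⟨hβ, fun i j x hx y hy t => ?_⟩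
  rw [hbr, hbr, hbr, map_smul, map_smul, map_smul, LinearMap.smul_apply,
    skewForm_swap_of_even hβ hz x, skewForm_swap_of_even hβ hz y, hβz, hβz, hβz]
  rcases zmod_two_cases i with rfl | rfl
  · simp; ring
  · rw [ha x hx, hb x hx]
    rcases zmod_two_cases j with rfl | rfl
    · simp
    · rw [ha y hy, hb y hy]; simp

end Heisenberg

variable (F) in
/-- The first coordinate functional of `H(1, 0)`. -/
def heisU : Module.Dual F (H F 1 0) where
  toFun x := (H.toProd F 1 0 x).1.1 0
  map_add' _ _ := rfl
  map_smul' _ _ := rfl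

variable (F) in
/-- The second coordinate functional of `H(1, 0)`. -/
def heisV : Module.Dual F (H F 1 0) where
  toFun x := (H.toProd F 1 0 x).1.2.1 0
  map_add' _ _ := rfl
  map_smul' _ _ := rfl

variable (F) in
/-- The element `a u + b v + c z` of `H(1, 0)`. -/
def heisMk (a b c : F) : H F 1 0 := (H.toProd F 1 0).symm ((fun _ => a, fun _ => b, c), 0)

theorem heisU_heisMk (a b c : F) : heisU F (heisMk F a b c) = a := rfl

theorem heisV_heisMk (a b c : F) : heisV F (heisMk F a b c) = b := rfl

theorem heisMk_ne_zero : heisMk F 0 0 1 ≠ 0 := by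
  intro h
  have := congrArg (fun x => (H.toProd F 1 0 x).1.2.2) h
  exact one_ne_zero this

theorem part_one_H (x : H F 1 0) (hx : x ∈ part (F := F) 1) : x = 0 := by
  have hx' : (H.toProd F 1 0 x).1 = 0 := (mem_prodPart_one _).1 hx
  apply (H.toProd F 1 0).injective
  exact Prod.ext hx' (Subsingleton.elim _ _)

theorem mem_part_zero_H (x : H F 1 0) : x ∈ part (F := F) 0 :=
  (mem_prodPart_zero _).2 (Subsingleton.elim _ _)

theorem eq_heisMk_combination (x : H F 1 0) : ∃ c : F, x =
    heisU F x • heisMk F 1 0 0 + heisV F x • heisMk F 0 1 0 + c • heisMk F 0 0 1 := by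
  refine ⟨(H.toProd F 1 0 x).1.2.2, (H.toProd F 1 0).injective ?_⟩
  refine Prod.ext (Prod.ext (funext fun i => ?_) (Prod.ext (funext fun i => ?_) ?_))
    (Subsingleton.elim _ _)
  · rw [Subsingleton.elim i 0]; simp [heisMk]; rfl
  · rw [Subsingleton.elim i 0]; simp [heisMk]; rfl
  · simp [heisMk]

theorem br_H_one_zero (x y : H F 1 0) : br (F := F) x y =
    (heisU F x * heisV F y - heisV F x * heisU F y) • heisMk F 0 0 1 := by
  rw [br_H_eq, heisForm_one_zero, ← mul_one (_ - _), heisZ_mul]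
  rfl

theorem br_H_prod_Ab {m n : ℕ} (x y : H F 1 0 × Ab F m n) : br (F := F) x y =
    ((heisU F ∘ₗ LinearMap.fst F _ _) x * (heisV F ∘ₗ LinearMap.fst F _ _) y -
      (heisV F ∘ₗ LinearMap.fst F _ _) x * (heisU F ∘ₗ LinearMap.fst F _ _) y) •
        ((heisMk F 0 0 1, 0) : H F 1 0 × Ab F m n) := by
  have h : br (F := F) x y = (br (F := F) x.1 y.1, br (F := F) x.2 y.2) := rfl
  have h' : br (F := F) x.2 y.2 = 0 := rfl
  rw [h, h', br_H_one_zero, Prod.smul_mk, smul_zero]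
  rfl

theorem br_br_H_one_zero (x y z : H F 1 0) : br (F := F) x (br (F := F) y z) = 0 := by
  rw [br_H_one_zero y z, map_smul, br_H_one_zero x, heisU_heisMk, heisV_heisMk]
  simp

theorem br_br_H_prod_Ab {m n : ℕ} (x y z : H F 1 0 × Ab F m n) :
    br (F := F) x (br (F := F) y z) = 0 :=
  Prod.ext (br_br_H_one_zero x.1 y.1 z.1) rfl

theorem br_br_H_zero_one (x y z : H F 0 1) : br (F := F) x (br (F := F) y z) = 0 := by
  rw [br_H_eq y z, br_H_eq, heisForm_heisZ_right, heisZ_zero]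

variable [CharZero F]

theorem smr_H_one_zero : smr F (H F 1 0) = (1, 0) := by
  have hz := mem_part_zero_H (heisMk F 0 0 1)
  refine smr_of_cocycles_eq hz heisMk_ne_zero
    (derived_eq_span_of_forall (u := heisMk F 1 0 0) (v := heisMk F 0 1 0) ?_ fun x y => ?_)
    fun β hβ => mem_cocycles_of_even_heisenberg hz (a := heisU F) (b := heisV F)
      (p := β (heisMk F 0 0 1) (heisMk F 1 0 0)) (q := β (heisMk F 0 0 1) (heisMk F 0 1 0))
      (fun x hx => ?_) (fun x hx => ?_) br_H_one_zero hβ fun x => ?_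
  · rw [br_H_one_zero]
    simp [heisU_heisMk, heisV_heisMk]
  · rw [br_H_one_zero]
    exact Submodule.mem_span_singleton.2 ⟨_, rfl⟩
  · rw [part_one_H x hx, map_zero]
  · rw [part_one_H x hx, map_zero]
  -- As `β z z = 0`, the functional `β(z, ·)` depends only on the `u` and `v` coordinates.
  · obtain ⟨c, hc⟩ := eq_heisMk_combination x
    conv_lhs => rw [hc]
    simp [skewForm_self_of_even hβ hz]

/-- Beyond `H(1,0)` the only new obstruction is `β z w`: the cocycle identity at `(u, v, w)` forces
it to vanish, and once it does, `β(z, ·)` again depends only on the `u` and `v` coordinates. -/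
theorem smr_H_prod_Ab {m n : ℕ} {i : ZMod 2} {w : Ab F m n} (hw : w ∈ part (F := F) i)
    (hw0 : w ≠ 0) (hspan : ∀ y : Ab F m n, ∃ k : F, y = k • w) :
    smr F (H F 1 0 × Ab F m n) = if i = 0 then (2, 0) else (1, 1) := by
  have hpart : ∀ x : H F 1 0, ((x, 0) : H F 1 0 × Ab F m n) ∈ part (F := F) 0 := fun x =>
    ⟨mem_part_zero_H x, Submodule.zero_mem _⟩
  have hz := hpart (heisMk F 0 0 1)
  have huv : br (F := F) ((heisMk F 1 0 0, 0) : H F 1 0 × Ab F m n) (heisMk F 0 1 0, 0) =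
      (heisMk F 0 0 1, 0) := by
    rw [br_H_prod_Ab]
    simp [heisU_heisMk, heisV_heisMk]
  have hcomm : ∀ x : H F 1 0 × Ab F m n, br (F := F) x ((0, w) : H F 1 0 × Ab F m n) = 0 :=
    fun x => by
      rw [br_H_prod_Ab]
      simp
  refine smr_of_mem_cocycles_iff (z := (heisMk F 0 0 1, 0)) (w := (0, w)) hz
    (fun h => heisMk_ne_zero (congrArg Prod.fst h))
    (derived_eq_span_of_forall huv fun x y => ?_) ⟨Submodule.zero_mem _, hw⟩ (fun hmem => ?_)
    fun β hβ => ⟨fun hc => ?_, fun h0 => ?_⟩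
  · rw [br_H_prod_Ab]
    exact Submodule.mem_span_singleton.2 ⟨_, rfl⟩
  · obtain ⟨k, hk⟩ := Submodule.mem_span_singleton.1 hmem
    have := congrArg Prod.snd hk
    simp only [Prod.smul_snd, smul_zero] at this
    exact hw0 this.symm
  · have := hc.2 0 0 _ (hpart (heisMk F 1 0 0)) _ (hpart (heisMk F 0 1 0)) (0, w)
    rw [hcomm, hcomm, huv, map_zero, map_zero, smul_zero, add_zero] at this
    exact this.symm
  · refine mem_cocycles_of_even_heisenberg hz
      (p := β (heisMk F 0 0 1, 0) (heisMk F 1 0 0, 0))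
      (q := β (heisMk F 0 0 1, 0) (heisMk F 0 1 0, 0))
      (fun x hx => ?_) (fun x hx => ?_) br_H_prod_Ab hβ fun x => ?_
    · rw [LinearMap.comp_apply, LinearMap.fst_apply, part_one_H x.1 hx.1, map_zero]
    · rw [LinearMap.comp_apply, LinearMap.fst_apply, part_one_H x.1 hx.1, map_zero]
    · obtain ⟨c, hc⟩ := eq_heisMk_combination x.1
      obtain ⟨k, hk⟩ := hspan x.2
      have hx : x = heisU F x.1 • ((heisMk F 1 0 0, 0) : H F 1 0 × Ab F m n) +
          heisV F x.1 • ((heisMk F 0 1 0, 0) : H F 1 0 × Ab F m n) +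
          c • ((heisMk F 0 0 1, 0) : H F 1 0 × Ab F m n) + k • ((0, w) : H F 1 0 × Ab F m n) := by
        refine Prod.ext ?_ ?_
        · simpa using hc
        · simpa using hk
      conv_lhs => rw [hx]
      simp only [map_add, map_smul, h0, skewForm_self_of_even hβ hz]
      simp

theorem smr_H_prod_Ab_one_zero : smr F (H F 1 0 × Ab F 1 0) = (2, 0) := by
  refine (smr_H_prod_Ab (i := 0) (w := (Ab.toProd F 1 0).symm (fun _ => 1, 0)) ?_ ?_ ?_).trans
    (if_pos rfl)
  · exact (mem_prodPart_zero _).2 rfl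
  · intro h
    exact one_ne_zero (congrArg (fun x => (Ab.toProd F 1 0 x).1 0) h)
  · intro y
    refine ⟨(Ab.toProd F 1 0 y).1 0, (Ab.toProd F 1 0).injective ?_⟩
    refine Prod.ext (funext fun i => ?_) (Subsingleton.elim _ _)
    rw [Subsingleton.elim i 0]
    simp

theorem smr_H_prod_Ab_zero_one : smr F (H F 1 0 × Ab F 0 1) = (1, 1) := by
  refine (smr_H_prod_Ab (i := 1) (w := (Ab.toProd F 0 1).symm (0, fun _ => 1)) ?_ ?_ ?_).trans
    (if_neg one_ne_zero)
  · exact (mem_prodPart_one _).2 rfl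
  · intro h
    exact one_ne_zero (congrArg (fun x => (Ab.toProd F 0 1 x).2 0) h)
  · intro y
    refine ⟨(Ab.toProd F 0 1 y).2 0, (Ab.toProd F 0 1).injective ?_⟩
    refine Prod.ext (Subsingleton.elim _ _) (funext fun i => ?_)
    rw [Subsingleton.elim i 0]
    simp

theorem smr_H_zero_one : smr F (H F 0 1) = (1, 1) := by
  let z : H F 0 1 := heisZ 1
  let w : H F 0 1 := (H.toProd F 0 1).symm (0, fun _ => 1)
  have hbr : ∀ x y : H F 0 1, br (F := F) x y =
      ((H.toProd F 0 1 x).2 0 * (H.toProd F 0 1 y).2 0) • z := fun x y => by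
    rw [br_H_eq, heisForm_zero_one, ← mul_one (_ * _), heisZ_mul]
    simp [z]
  have hz : z ∈ part (F := F) 0 := (mem_prodPart_zero _).2 rfl
  have hw : w ∈ part (F := F) 1 := (mem_prodPart_one _).2 rfl
  have hz0 : z ≠ 0 := fun h => one_ne_zero (congrArg (fun x => (H.toProd F 0 1 x).1.2.2) h)
  have hw0 : w ≠ 0 := fun h => one_ne_zero (congrArg (fun x => (H.toProd F 0 1 x).2 0) h)
  have hww : br (F := F) w w = z := by
    rw [hbr]
    simp [w]
  refine (smr_of_mem_cocycles_iff hz hz0 (derived_eq_span_of_forall hww fun x y => ?_) hw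
    (fun hmem => hw0 ?_) fun β hβ => ⟨fun hc => ?_, fun h0 => ?_⟩).trans (if_neg one_ne_zero)
  · rw [hbr]
    exact Submodule.mem_span_singleton.2 ⟨_, rfl⟩
  · exact eq_zero_of_mem_part_of_mem_part one_ne_zero hw
      ((Submodule.span_singleton_le_iff_mem _ _).2 hz hmem)
  -- The cocycle identity at `(w, w, w)` amounts to `3 β(z, w) = 0`.
  · have h := hc.2 1 1 w hw w hw w
    rw [hww, skewForm_swap_of_even hβ hz w] at h
    simp only [ZMod.val_one, mul_one, pow_one, neg_smul, one_smul, neg_neg] at h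
    have h3 : (3 : F) * β z w = 0 := by linear_combination -h
    simpa using h3
  -- Conversely `β(z, ·) = 0`, and since all brackets are multiples of `z`, every term of the
  -- identity vanishes.
  · have hβz : ∀ x, β z x = 0 := fun x => by
      have hx : x = (H.toProd F 0 1 x).1.2.2 • z + (H.toProd F 0 1 x).2 0 • w := by
        apply (H.toProd F 0 1).injective
        refine Prod.ext (Prod.ext (Subsingleton.elim _ _) (Prod.ext (Subsingleton.elim _ _) ?_))
          (funext fun i => ?_)
        · simp [z, w, heisZ]
        · rw [Subsingleton.elim i 0]; simp [z, w, heisZ]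
      rw [hx, map_add, map_smul, map_smul, h0, skewForm_self_of_even hβ hz]
      simp
    refine ⟨hβ, fun i j x _ y _ t => ?_⟩
    rw [hbr, hbr, hbr, map_smul, map_smul, map_smul, LinearMap.smul_apply,
      skewForm_swap_of_even hβ hz x, skewForm_swap_of_even hβ hz y, hβz, hβz, hβz]
    simp

end Models

end LieSuperalgebra

/-! ### Assembly of the theorem. -/

open LieSuperalgebra in
theorem mainTheorem1 {F : Type u} [Field F] [IsAlgClosed F] [CharZero F]
    {L : Type v} [AddCommGroup L] [Module F L] [FiniteDimensional F L] [LieSuperalgebra F L] :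
    (∃! d : ℕ × ℕ, IsMultiplierSdim F L d) ∧
    ((Nilpotent F L ∧ mr F L ≤ 2) ↔
      (Abelian F L ∨ Iso F L (H F 1 0) ∨ Iso F L (H F 1 0 × Ab F 1 0) ∨
        Iso F L (H F 1 0 × Ab F 0 1) ∨ Iso F L (H F 0 1))) ∧
    (smr F L = (0, 0) ↔ Abelian F L) ∧
    ((Nilpotent F L ∧ smr F L = (1, 0)) ↔ Iso F L (H F 1 0)) ∧
    ((Nilpotent F L ∧ smr F L = (2, 0)) ↔ Iso F L (H F 1 0 × Ab F 1 0)) ∧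
    ((Nilpotent F L ∧ smr F L = (1, 1)) ↔
      (Iso F L (H F 1 0 × Ab F 0 1) ∨ Iso F L (H F 0 1))) := by
  have hA : Abelian F L → Nilpotent F L ∧ smr F L = (0, 0) :=
    fun h => ⟨h.nilpotent, h.smr_eq⟩
  have h1 : Iso F L (H F 1 0) → Nilpotent F L ∧ smr F L = (1, 0) :=
    fun h => ⟨h.nilpotent br_br_H_one_zero, h.smr_eq.trans smr_H_one_zero⟩
  have h2 : Iso F L (H F 1 0 × Ab F 1 0) → Nilpotent F L ∧ smr F L = (2, 0) :=
    fun h => ⟨h.nilpotent br_br_H_prod_Ab, h.smr_eq.trans smr_H_prod_Ab_one_zero⟩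
  have h3 : Iso F L (H F 1 0 × Ab F 0 1) → Nilpotent F L ∧ smr F L = (1, 1) :=
    fun h => ⟨h.nilpotent br_br_H_prod_Ab, h.smr_eq.trans smr_H_prod_Ab_zero_one⟩
  have h4 : Iso F L (H F 0 1) → Nilpotent F L ∧ smr F L = (1, 1) :=
    fun h => ⟨h.nilpotent br_br_H_zero_one, h.smr_eq.trans smr_H_zero_one⟩
  have hmr : ∀ a b : ℤ, smr F L = (a, b) → mr F L = a + b := fun a b h => by rw [mr, h]
  have hcl : Nilpotent F L → mr F L ≤ 2 → Abelian F L ∨ Iso F L (H F 1 0) ∨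
      Iso F L (H F 1 0 × Ab F 1 0) ∨ Iso F L (H F 1 0 × Ab F 0 1) ∨ Iso F L (H F 0 1) :=
    fun hn hle => (em (Abelian F L)).imp_right (hn.iso_of_mr_le_two hle)
  -- Each prescribed value of `smr` has `mr ≤ 2`, so the classification applies; comparison with the
  -- computed values of the models then discards the wrong ones.
  have hcl' : ∀ a b : ℤ, a + b ≤ 2 → Nilpotent F L → smr F L = (a, b) →
      Abelian F L ∨ Iso F L (H F 1 0) ∨ Iso F L (H F 1 0 × Ab F 1 0) ∨
        Iso F L (H F 1 0 × Ab F 0 1) ∨ Iso F L (H F 0 1) :=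
    fun a b hab hn h => hcl hn ((hmr a b h).trans_le hab)
  refine ⟨existsUnique_isMultiplierSdim F L, ⟨fun h => hcl h.1 h.2, ?_⟩, smr_eq_zero_iff,
    ⟨fun h => ?_, h1⟩, ⟨fun h => ?_, h2⟩, ⟨fun h => ?_, fun h => h.elim h3 h4⟩⟩
  · rintro (h | h | h | h | h)
    · exact ⟨(hA h).1, by rw [hmr _ _ (hA h).2]; norm_num⟩
    · exact ⟨(h1 h).1, by rw [hmr _ _ (h1 h).2]; norm_num⟩
    · exact ⟨(h2 h).1, by rw [hmr _ _ (h2 h).2]; norm_num⟩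
    · exact ⟨(h3 h).1, by rw [hmr _ _ (h3 h).2]; norm_num⟩
    · exact ⟨(h4 h).1, by rw [hmr _ _ (h4 h).2]; norm_num⟩
  · rcases hcl' 1 0 (by norm_num) h.1 h.2 with h' | h' | h' | h' | h'
    · exact absurd (h.2.symm.trans (hA h').2) (by decide)
    · exact h'
    · exact absurd (h.2.symm.trans (h2 h').2) (by decide)
    · exact absurd (h.2.symm.trans (h3 h').2) (by decide)
    · exact absurd (h.2.symm.trans (h4 h').2) (by decide)
  · rcases hcl' 2 0 (by norm_num) h.1 h.2 with h' | h' | h' | h' | h'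
    · exact absurd (h.2.symm.trans (hA h').2) (by decide)
    · exact absurd (h.2.symm.trans (h1 h').2) (by decide)
    · exact h'
    · exact absurd (h.2.symm.trans (h3 h').2) (by decide)
    · exact absurd (h.2.symm.trans (h4 h').2) (by decide)
  · rcases hcl' 1 1 (by norm_num) h.1 h.2 with h' | h' | h' | h' | h'
    · exact absurd (h.2.symm.trans (hA h').2) (by decide)
    · exact absurd (h.2.symm.trans (h1 h').2) (by decide)
    · exact absurd (h.2.symm.trans (h2 h').2) (by decide)
    · exact Or.inl h'
    · exact Or.inr h'
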